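/- A \emph{rooted Greg tree} of size $n$ is a finite tree with a distinguished vertex (the root), in which $n$ vertices carry the labels $1,\dots,n$ (each once) and the other vertices are unlabeled, such that every unlabeled vertex has degree at least $3$, except that an unlabeled root may also have degree $2$. Trees are considered up to isomorphisms preserving labels and root; $\mathcal G^\bullet_n$ is the (finite) set of rooted Greg trees of size $n$, and $\mathrm{unl}(T)$ is the number of unlabeled vertices of $T$. Let $\mathcal C^\bullet_m$ be the set of rooted Cayley trees of size $m$, i.e. rooted trees on the vertex set $\{1,\dots,m\}$. For $X\in\mathcal C^\bullet_m$ and $1\le n\le m$, let $X|_n$ be the tree obtained from $X$ by removing the labels greater than $n$ and then, as long as possible, removing an unlabeled non-root vertex of degree $2$ (joining its two edges into one edge) or an unlabeled vertex of degree $1$ together with its edge (if this vertex is the root, its neighbor becomes the root). Let $$T_1(z)=T(z)=\sum_{k\ge1}k^{k-1}\frac{z^k}{k!}.$$ \textbf{Proposition.} For $1\le n\le m$ and $X\in\mathcal C^\bullet_m$, the process above leads to exactly one element $X|_n$ of $\mathcal G^\bullet_n$. For every $T\in\mathcal G^\bullet_n$ we have, as formal power series over $\mathbb Q$, $$\sum_{m\ge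 n}\ \sum_{\substack{X\in\mathcal C^\bullet_m\\ X|_n=T}}\frac{z^{m-n}}{(m-n)!}=\frac{e^{nT(z)}}{(1-T(z))^n}\left(\frac{T(z)}{1-T(z)}\right)^{\mathrm{unl}(T)}.$$ Consequently, for every $n\ge1$, $$\frac{d^n}{dz^n}T_1(z)=\frac{e^{nT(z)}}{(1-T(z))^n}\,G_n\!\left(\frac{T(z)}{1-T(z)}\right),\qquad\text{where } G_n(x)=\sum_{T\in\mathcal G^\bullet_n}x^{\mathrm{unl}(T)}.$$ -/

import Mathlib

namespace GregTree

/-- A graph on `V` with a distinguished vertex (the root), in which `n` of the vertices carry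
the labels `1, …, n` (here the elements of `Fin n`); the other vertices are unlabeled. -/
structure RootedGraph (n : ℕ) (V : Type) where
  graph : SimpleGraph V
  label : Fin n ↪ V
  root : V

namespace RootedGraph

variable {n : ℕ} {V W U : Type}

/-- The vertex `v` carries no label. -/
def Unlabeled (S : RootedGraph n V) (v : V) : Prop :=
  v ∉ Set.range S.label

/-- The degree of a vertex (all vertex types used below are finite). -/
noncomputable def deg (S : RootedGraph n V) (v : V) : ℕ :=
  (S.graph.neighborSet v).ncard

/-- The number of unlabeled vertices. -/
noncomputable def unl (S : RootedGraph n V) : ℕ :=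
  {v | S.Unlabeled v}.ncard

/-- A tree in which every unlabeled vertex has degree at least `3`, except that an unlabeled root
may also have degree `2`. -/
def IsGreg (S : RootedGraph n V) : Prop :=
  S.graph.IsTree ∧
    ∀ v, S.Unlabeled v → 2 ≤ S.deg v ∧ (v ≠ S.root → 3 ≤ S.deg v)

/-- Isomorphism of partially labeled rooted graphs: a graph isomorphism that respects the labels
and the root. -/
def Iso (S : RootedGraph n V) (T : RootedGraph n W) : Prop :=
  ∃ e : S.graph ≃g T.graph, (∀ i, e (S.label i) = T.label i) ∧ e S.root = T.root

theorem Iso.refl (S : RootedGraph n V) : S.Iso S :=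
  ⟨RelIso.refl _, fun _ => rfl, rfl⟩

theorem Iso.symm {S : RootedGraph n V} {T : RootedGraph n W} (h : S.Iso T) : T.Iso S := by
  obtain ⟨e, h1, h2⟩ := h
  exact ⟨e.symm, fun i => by rw [← h1 i]; simp, by rw [← h2]; simp⟩

theorem Iso.trans {S : RootedGraph n V} {T : RootedGraph n W} {R : RootedGraph n U}
    (h : S.Iso T) (h' : T.Iso R) : S.Iso R := by
  obtain ⟨e, h1, h2⟩ := h
  obtain ⟨f, h3, h4⟩ := h'
  exact ⟨e.trans f, fun i => by simp [h1, h3], by simp [h2, h4]⟩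

theorem Iso.unl_eq {S : RootedGraph n V} {T : RootedGraph n W} (h : S.Iso T) :
    S.unl = T.unl := by
  obtain ⟨e, h1, -⟩ := h
  have : {v | T.Unlabeled v} = e '' {v | S.Unlabeled v} := by
    ext w
    simp only [Unlabeled, Set.mem_range, not_exists, Set.mem_ofPred_eq, Set.mem_image]
    constructor
    · intro hw
      refine ⟨e.symm w, fun i hi => hw i ?_, by simp⟩
      rw [← h1 i, hi]; simp
    · rintro ⟨v, hv, rfl⟩ i hi
      rw [← h1 i] at hi
      exact hv i (e.injective hi)
  unfold unl
  rw [this, Set.ncard_image_of_injective _ e.injective]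

/-- The labels, after the deletion of an unlabeled vertex. -/
def labelAvoiding (S : RootedGraph n V) (v : V) (hv : S.Unlabeled v) : Fin n ↪ {w // w ≠ v} where
  toFun i := ⟨S.label i, fun h => hv ⟨i, h⟩⟩
  inj' _ _ h := S.label.injective (congrArg Subtype.val h)

/-- Remove an unlabeled vertex `v` and the incident edges; `r` is the root of the result. -/
def prune (S : RootedGraph n V) (v : V) (hv : S.Unlabeled v) (r : {w // w ≠ v}) :
    RootedGraph n {w // w ≠ v} where
  graph := S.graph.comap Subtype.val
  label := S.labelAvoiding v hv
  root := r

/-- Remove an unlabeled vertex `v` that is not the root, and join its neighbors to each other.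
For a vertex `v` of degree `2` the two edges at `v` become a single edge. -/
def smooth (S : RootedGraph n V) (v : V) (hv : S.Unlabeled v) (hr : S.root ≠ v) :
    RootedGraph n {w // w ≠ v} where
  graph :=
    { Adj := fun a b => a ≠ b ∧
        (S.graph.Adj a.1 b.1 ∨ (S.graph.Adj a.1 v ∧ S.graph.Adj b.1 v))
      symm := ⟨fun _ _ h => ⟨h.1.symm, h.2.imp (fun h' => h'.symm) And.symm⟩⟩
      loopless := ⟨fun _ h => h.1 rfl⟩ }
  label := S.labelAvoiding v hv
  root := ⟨S.root, hr⟩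

/-- `S.ReducesTo T`: one can go from `S` to `T` by finitely many steps of the following kinds:
* remove an unlabeled vertex of degree `2` which is not the root, joining its two edges into one;
* remove an unlabeled vertex of degree `1` which is not the root, with its edge;
* remove an unlabeled root of degree `1`, with its edge; its neighbor becomes the root. -/
inductive ReducesTo {n : ℕ} : {V W : Type} → RootedGraph n V → RootedGraph n W → Prop
  | refl {V : Type} (S : RootedGraph n V) : ReducesTo S S
  | smooth {V W : Type} {S : RootedGraph n V} {T : RootedGraph n W}
      (v : V) (hv : S.Unlabeled v) (hr : S.root ≠ v) (hdeg : S.deg v = 2)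
      (h : ReducesTo (S.smooth v hv hr) T) : ReducesTo S T
  | pruneLeaf {V W : Type} {S : RootedGraph n V} {T : RootedGraph n W}
      (v : V) (hv : S.Unlabeled v) (hr : S.root ≠ v) (hdeg : S.deg v = 1)
      (h : ReducesTo (S.prune v hv ⟨S.root, hr⟩) T) : ReducesTo S T
  | pruneRoot {V W : Type} {S : RootedGraph n V} {T : RootedGraph n W}
      (hv : S.Unlabeled S.root) (hdeg : S.deg S.root = 1)
      (w : V) (hw : S.graph.Adj w S.root)
      (h : ReducesTo (S.prune S.root hv ⟨w, hw.ne⟩) T) : ReducesTo S T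

end RootedGraph

/-- Concrete rooted Greg trees of size `n`, with vertex set `Fin k` for some `k`. -/
def GregRep (n : ℕ) : Type :=
  Σ k : ℕ, {S : RootedGraph n (Fin k) // S.IsGreg}

/-- Two concrete rooted Greg trees are identified if they are isomorphic. -/
instance gregSetoid (n : ℕ) : Setoid (GregRep n) where
  r S T := S.2.1.Iso T.2.1
  iseqv := ⟨fun S => RootedGraph.Iso.refl S.2.1, fun h => h.symm, fun h h' => h.trans h'⟩

/-- The set of rooted Greg trees of size `n`. -/
def RootedGregTree (n : ℕ) : Type :=
  Quotient (gregSetoid n)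

/-- The number of unlabeled vertices of a rooted Greg tree. -/
noncomputable def RootedGregTree.unl {n : ℕ} (T : RootedGregTree n) : ℕ :=
  Quotient.lift (fun S : GregRep n => S.2.1.unl) (fun _ _ h => RootedGraph.Iso.unl_eq h) T

/-- The set of rooted Cayley trees of size `m`: trees on the vertex set `{1, …, m}` (here `Fin m`)
with a distinguished vertex. -/
def RootedCayleyTree (m : ℕ) : Type :=
  {X : SimpleGraph (Fin m) × Fin m // X.1.IsTree}

/-- Remove all labels greater than `n` from a rooted Cayley tree of size `m ≥ n`. -/
def RootedCayleyTree.forget {m n : ℕ} (hnm : n ≤ m) (X : RootedCayleyTree m) :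
    RootedGraph n (Fin m) where
  graph := X.1.1
  label := Fin.castLEEmb hnm
  root := X.1.2

/-- The relation `X|ₙ = T`: after the labels greater than `n` have been removed, the removal of
unlabeled vertices of degrees `1` and `2` leads to the rooted Greg tree `T`. -/
def RootedCayleyTree.RestrictsTo {m n : ℕ} (hnm : n ≤ m) (X : RootedCayleyTree m)
    (T : RootedGregTree n) : Prop :=
  ∃ (W : Type) (S : RootedGraph n W) (R : GregRep n),
    (X.forget hnm).ReducesTo S ∧ S.Iso R.2.1 ∧ Quotient.mk (gregSetoid n) R = T

/-- A rooted Greg tree of size `n` has at most `2 n` vertices, so there are finitely many. -/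
theorem GregRep.card_le {n : ℕ} (S : GregRep n) : S.1 ≤ 2 * n := by
  classical
  obtain ⟨k, S, htree, hdeg⟩ := S
  change k ≤ 2 * n
  have h1 := S.graph.sum_degrees_eq_twice_card_edges
  have h2 := htree.card_edgeFinset
  rw [Fintype.card_fin] at h2
  have hdd : ∀ v, S.deg v = S.graph.degree v := fun v => by
    unfold RootedGraph.deg
    rw [Set.ncard_eq_toFinset_card', ← SimpleGraph.neighborFinset_def,
      SimpleGraph.card_neighborFinset_eq_degree]
  set L : Finset (Fin k) := Finset.univ.map S.label with hL
  have hLc : L.card = n := by simp [hL]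
  have hU : ∀ v, v ∉ L → S.Unlabeled v := by
    intro v hv
    simpa [hL, RootedGraph.Unlabeled] using hv
  have hpos : ∀ v, 3 ≤ S.graph.degree v + (if v ∈ L then 2 else 0) +
      (if v = S.root then 1 else 0) ∨ k ≤ 1 := by
    intro v
    by_cases hk : k ≤ 1
    · exact Or.inr hk
    left
    have : Nontrivial (Fin k) := Fin.nontrivial_iff_two_le.2 (by omega)
    have hp : 0 < S.graph.degree v := htree.connected.preconnected.degree_pos_of_nontrivial v
    by_cases hv : v ∈ L
    · simp only [hv, if_true]; omega
    · have := hdeg v (hU v hv)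
      rw [hdd] at this
      by_cases hr : v = S.root
      · simp only [hr, if_true]; rw [← hr]; omega
      · have := this.2 hr
        omega
  by_cases hk : k ≤ 1
  · by_contra hcon
    have hn : n = 0 := by omega
    subst hn
    have := (hdeg S.root (by simp [RootedGraph.Unlabeled])).1
    rw [hdd] at this
    have := S.graph.degree_lt_card_verts S.root
    rw [Fintype.card_fin] at this
    omega
  · have h3 : ∑ _v : Fin k, 3 ≤ ∑ v : Fin k, (S.graph.degree v + (if v ∈ L then 2 else 0) +
        (if v = S.root then 1 else 0)) :=
      Finset.sum_le_sum fun v _ => (hpos v).resolve_right hk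
    rw [Finset.sum_add_distrib, Finset.sum_add_distrib, h1, ← Finset.sum_filter] at h3
    simp [hLc] at h3
    omega

instance (n : ℕ) (V : Type) [Finite V] : Finite (RootedGraph n V) :=
  Finite.of_injective
    (fun S : RootedGraph n V => (S.graph, (S.label : Fin n → V), S.root)) (by
      rintro ⟨g, l, r⟩ ⟨g', l', r'⟩ h
      simp only [Prod.mk.injEq, DFunLike.coe_fn_eq] at h
      obtain ⟨rfl, rfl, rfl⟩ := h
      rfl)

instance (n : ℕ) : Finite (GregRep n) :=
  Finite.of_injective
    (fun S : GregRep n =>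
      (⟨⟨S.1, Nat.lt_succ_of_le S.card_le⟩, S.2.1⟩ :
        Σ k : Fin (2 * n + 1), RootedGraph n (Fin k))) (by
      rintro ⟨k, S, hS⟩ ⟨k', S', hS'⟩ h
      simp only [Sigma.mk.injEq, Fin.mk.injEq] at h
      obtain ⟨rfl, h⟩ := h
      obtain rfl := eq_of_heq h
      rfl)

instance (n : ℕ) : Finite (RootedGregTree n) :=
  inferInstanceAs (Finite (Quotient (gregSetoid n)))

noncomputable instance (n : ℕ) : Fintype (RootedGregTree n) :=
  Fintype.ofFinite _

instance (m : ℕ) : Finite (RootedCayleyTree m) :=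
  inferInstanceAs (Finite {X : SimpleGraph (Fin m) × Fin m // X.1.IsTree})

/-- The polynomial `Gₙ(x) = ∑ x ^ unl T`, summed over the rooted Greg trees `T` of size `n`. -/
noncomputable def gregPoly (n : ℕ) : Polynomial ℚ :=
  ∑ T : RootedGregTree n, Polynomial.X ^ T.unl

/-- The tree function `T(z) = T₁(z) = ∑_{k ≥ 1} k ^ (k - 1) z ^ k / k!`. -/
noncomputable def treeFunction : PowerSeries ℚ :=
  PowerSeries.mk fun k => if k = 0 then 0 else (k : ℚ) ^ (k - 1) / (k.factorial : ℚ)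

/-- The exponential generating function of the rooted Cayley trees `X` with `X|ₙ = T`, by the
number `k = m - n` of labels greater than `n`. -/
noncomputable def restrictionSeries {n : ℕ} (T : RootedGregTree n) : PowerSeries ℚ :=
  PowerSeries.mk fun k =>
    (Nat.card {X : RootedCayleyTree (n + k) // X.RestrictsTo (Nat.le_add_right n k) T} : ℚ) /
      (k.factorial : ℚ)

/-- The series `e^{n T(z)}`. -/
noncomputable def expTree (n : ℕ) : PowerSeries ℚ :=
  (PowerSeries.exp ℚ).subst ((n : PowerSeries ℚ) * treeFunction)

end GregTree

/-! A rooted tree is encoded by the family of nonempty label sets lying below its vertices. This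
family is laminar, contains the full set and separates labels (`IsHierarchy`). It survives each
reduction step (`ReducesTo.fam_eq`), and it determines a Greg tree up to isomorphism
(`IsGreg.iso_of_fam_eq`). Every hierarchy arises from its Hasse diagram (`isGreg_toRootedGraph`). So
Greg trees of size `n` are hierarchies on `n` points, with `unl` equal to the cardinality minus `n`;
Cayley trees are those with exactly as many members as points, and `X|ₙ` becomes the trace on the
first `n` points (`restrictsTo_iff`, `fam_forget`).

Traces can be taken one point at a time. A new label enters a tree at a vertex `M` in one of four
ways: on `M` itself if `M` is unlabeled, as a new parent of `M`, as a new leaf below `M`, or as a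
leaf at a new unlabeled parent of `M`. A tree with `u` unlabeled vertices thus has `u`, `2(n+u)` and
`n+u` extensions with `u-1`, `u` and `u+1` unlabeled vertices (`sum_restrictFam_eq`).

The series `gregSeries n u` obey the same recurrence under `d/dz` (`derivative_gregSeries`), since
`T' = e^T/(1-T)`; this rests on `T = z e^T`, obtained from an Abel identity. Induction on `m - n`
gives the count of Cayley trees, and induction on `n` gives the iterated derivatives. -/

namespace GregTree
namespace RootedGraph
-- Rooted trees as partial orders
section TreeOrder
variable {n : ℕ} {V W : Type}

/-- The vertex `w` lies on every walk from `v` to the root. -/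
def Anc (S : RootedGraph n V) (v w : V) : Prop :=
  ∀ p : S.graph.Walk v S.root, w ∈ p.support

/-- The order on the vertices is the descendant order of the rooted tree `S`: the root is the
greatest vertex, the vertices above a given one form a chain, and the edges are the covering
pairs. -/
structure TreeOrder (S : RootedGraph n V) [PartialOrder V] : Prop where
  le_root : ∀ v, v ≤ S.root
  chain : ∀ {a b c : V}, a ≤ b → a ≤ c → b ≤ c ∨ c ≤ b
  adj_iff : ∀ {a b : V}, S.graph.Adj a b ↔ a ⋖ b ∨ b ⋖ a

namespace TreeOrder

variable {S : RootedGraph n V} [PartialOrder V] (h : S.TreeOrder)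
include h

theorem covBy_unique {a b c : V} (hb : a ⋖ b) (hc : a ⋖ c) : b = c := by
  rcases h.chain hb.le hc.le with hbc | hcb
  · exact (hc.eq_or_eq hb.le hbc).resolve_left hb.ne'
  · exact ((hb.eq_or_eq hc.le hcb).resolve_left hc.ne').symm

/-- A walk can leave the down-set of `w` only through `w`: the parent of a vertex below `w` is
comparable with `w`, and covering keeps it from being strictly above. -/
theorem mem_support_of_le {v w : V} (hvw : v ≤ w) (p : S.graph.Walk v S.root) :
    w ∈ p.support := by
  suffices H : ∀ {x r : V} (p : S.graph.Walk x r), (∀ y, y ≤ r) → x ≤ w → w ∈ p.support from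
    H p h.le_root hvw
  intro x r p hr
  induction p with
  | nil => intro hx; simp [le_antisymm (hr w) hx]
  | @cons x u r hxu q ih =>
    intro hx
    rw [SimpleGraph.Walk.support_cons]
    rcases eq_or_lt_of_le hx with rfl | hlt
    · simp
    · refine List.mem_cons_of_mem _ (ih hr ?_)
      rcases h.adj_iff.1 hxu with hc | hc
      · rcases h.chain hc.le hlt.le with h1 | h1
        · exact h1
        · rcases hc.eq_or_eq hlt.le h1 with h2 | h2
          · exact absurd h2 hlt.ne'
          · exact h2.ge
      · exact hc.le.trans hx

theorem exists_walk [Finite V] (v : V) :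
    ∃ p : S.graph.Walk v S.root, ∀ w ∈ p.support, v ≤ w := by
  induction v using (Finite.wellFounded_of_trans_of_irrefl (α := V) (· > ·)).induction with
  | _ v ih =>
    by_cases hv : v = S.root
    · subst hv
      exact ⟨.nil, by simp⟩
    · obtain ⟨u, hu, -⟩ := exists_covBy_le_of_lt (lt_of_le_of_ne (h.le_root v) hv)
      obtain ⟨p, hp⟩ := ih u hu.lt
      refine ⟨.cons (h.adj_iff.2 (.inl hu)) p, fun w hw => ?_⟩
      rw [SimpleGraph.Walk.support_cons, List.mem_cons] at hw
      rcases hw with rfl | hw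
      · exact le_rfl
      · exact hu.le.trans (hp w hw)

theorem anc_iff [Finite V] {v w : V} : S.Anc v w ↔ v ≤ w := by
  refine ⟨fun hvw => ?_, fun hvw p => h.mem_support_of_le hvw p⟩
  obtain ⟨p, hp⟩ := h.exists_walk v
  exact hp w (hvw p)

/-- Climbing to the root gives connectedness. An edge `a ⋖ b` is a bridge because it is the only
edge leaving the down-set of `a`. -/
theorem isTree [Finite V] : S.graph.IsTree := by
  refine ⟨?_, ?_⟩
  · rw [SimpleGraph.connected_iff_exists_forall_reachable]
    refine ⟨S.root, fun v => ?_⟩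
    obtain ⟨p, -⟩ := h.exists_walk v
    exact ⟨p.reverse⟩
  · rw [SimpleGraph.isAcyclic_iff_forall_adj_isBridge]
    have key : ∀ a b, a ⋖ b → S.graph.IsBridge s(a, b) := by
      intro a b hab
      rw [SimpleGraph.isBridge_iff]
      rintro ⟨p⟩
      suffices H : ∀ {x y : V} (p : (S.graph.deleteEdges {s(a, b)}).Walk x y), x ≤ a → y ≤ a from
        hab.lt.not_ge (H p le_rfl)
      intro x y p
      induction p with
      | nil => exact id
      | @cons x u y hxu q ih =>
        intro hx
        refine ih ?_
        rw [SimpleGraph.deleteEdges_adj, Set.mem_singleton_iff] at hxu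
        rcases h.adj_iff.1 hxu.1 with hc | hc
        · rcases eq_or_lt_of_le hx with rfl | hlt
          · exact absurd (by rw [h.covBy_unique hab hc]) hxu.2
          · rcases h.chain hc.le hlt.le with h1 | h1
            · exact h1
            · rcases hc.eq_or_eq hlt.le h1 with h2 | h2
              · exact absurd h2 hlt.ne'
              · exact h2.ge
        · exact hc.le.trans hx
    intro a b hab
    rcases h.adj_iff.1 hab with hc | hc
    · exact key a b hc
    · rw [Sym2.eq_swap]
      exact key b a hc

theorem neighborSet_eq (v : V) : S.graph.neighborSet v = {c | c ⋖ v} ∪ {p | v ⋖ p} := by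
  ext w
  simp [h.adj_iff, or_comm]

theorem deg_root : S.deg S.root = {c | c ⋖ S.root}.ncard := by
  have : {p | S.root ⋖ p} = ∅ := by
    ext p
    simp only [Set.mem_ofPred_eq, Set.mem_empty_iff_false, iff_false]
    exact fun hp => (h.le_root p).not_gt hp.lt
  rw [deg, h.neighborSet_eq, this, Set.union_empty]

theorem deg_of_ne_root [Finite V] {v : V} (hv : v ≠ S.root) :
    S.deg v = {c | c ⋖ v}.ncard + 1 := by
  obtain ⟨u, hu, -⟩ := exists_covBy_le_of_lt (lt_of_le_of_ne (h.le_root v) hv)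
  have : {p | v ⋖ p} = {u} := by
    ext p
    simp only [Set.mem_ofPred_eq, Set.mem_singleton_iff]
    exact ⟨fun hp => h.covBy_unique hp hu, fun hp => hp ▸ hu⟩
  rw [deg, h.neighborSet_eq, this, Set.ncard_union_eq, Set.ncard_singleton]
  rw [Set.disjoint_singleton_right]
  exact fun hc => lt_asymm hu.lt (CovBy.lt hc)

/-- Every vertex except the root has exactly one parent, so the separate degree bounds for root and
non-root merge into one bound on children. -/
theorem isGreg_iff [Finite V] :
    S.IsGreg ↔ ∀ v, S.Unlabeled v → 2 ≤ {c | c ⋖ v}.ncard := by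
  constructor
  · intro hS v hv
    have h1 := hS.2 v hv
    by_cases hr : v = S.root
    · subst hr
      rw [← h.deg_root]
      exact h1.1
    · have h2 := h1.2 hr
      rw [h.deg_of_ne_root hr] at h2
      omega
  · intro hS
    refine ⟨h.isTree, fun v hv => ?_⟩
    have h1 := hS v hv
    by_cases hr : v = S.root
    · subst hr
      rw [h.deg_root]
      exact ⟨h1, fun h2 => absurd rfl h2⟩
    · rw [h.deg_of_ne_root hr]
      omega

end TreeOrder

theorem anc_comap {S : RootedGraph n V} {T : RootedGraph n W} (e : S.graph ≃g T.graph)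
    (hr : e S.root = T.root) {v w : V} (hvw : T.Anc (e v) (e w)) : S.Anc v w := by
  intro p
  have := hvw ((p.map e.toHom).copy rfl hr)
  simpa using this

theorem anc_iff_of_iso {S : RootedGraph n V} {T : RootedGraph n W} (e : S.graph ≃g T.graph)
    (hr : e S.root = T.root) {v w : V} : T.Anc (e v) (e w) ↔ S.Anc v w := by
  refine ⟨anc_comap e hr, fun hvw => ?_⟩
  refine anc_comap e.symm (by rw [← hr]; simp) ?_
  simpa using hvw

/-! ### The descendant order of a rooted tree -/

section Path
variable {S : RootedGraph n V} (hS : S.graph.IsTree)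
include hS

/-- Erasing the loops of any walk to the root leaves the unique path, so every walk meets all
vertices of that path. -/
theorem anc_of_mem_path {v w : V} {p : S.graph.Walk v S.root} (hp : p.IsPath)
    (hw : w ∈ p.support) : S.Anc v w := by
  classical
  intro q
  have := (hS.2.subsingleton_path _ _).elim ⟨p, hp⟩ q.toPath
  have h2 : p = (q.toPath : S.graph.Walk v S.root) := congrArg Subtype.val this
  rw [h2] at hw
  exact q.support_toPath_subset_support hw

theorem exists_isPath (v : V) : ∃ p : S.graph.Walk v S.root, p.IsPath :=
  (hS.existsUnique_path v S.root).exists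

theorem anc_antisymm {v w : V} (h1 : S.Anc v w) (h2 : S.Anc w v) : v = w := by
  classical
  obtain ⟨p, hp⟩ := exists_isPath hS v
  have hw := h1 p
  have hv := h2 (p.dropUntil w hw)
  by_contra hne
  cases p with
  | nil => simp at hw; exact hne hw.symm
  | cons ha q =>
    rw [SimpleGraph.Walk.cons_isPath_iff] at hp
    have hwq : w ∈ q.support := by
      rw [SimpleGraph.Walk.support_cons, List.mem_cons] at hw
      exact hw.resolve_left (Ne.symm hne)
    -- The part of the path from `w` on would visit `v` a second time.
    exact hp.2 (q.support_dropUntil_subset_support hwq (h2 (q.dropUntil w hwq)))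

omit hS in
theorem anc_trans {u v w : V} (h1 : S.Anc u v) (h2 : S.Anc v w) : S.Anc u w := by
  classical
  intro p
  exact p.support_dropUntil_subset_support (h1 p) (h2 (p.dropUntil v (h1 p)))

theorem anc_chain {u v w : V} (h1 : S.Anc u v) (h2 : S.Anc u w) : S.Anc v w ∨ S.Anc w v := by
  obtain ⟨p, hp⟩ := exists_isPath hS u
  suffices H : ∀ {x r : V} (p : S.graph.Walk x r), r = S.root → p.IsPath → v ∈ p.support →
      w ∈ p.support → S.Anc v w ∨ S.Anc w v from H p rfl hp (h1 p) (h2 p)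
  intro x r p hr hp hv hw
  induction p with
  | nil =>
    rw [SimpleGraph.Walk.support_nil, List.mem_singleton] at hv hw
    subst hv hw
    exact .inl fun q => q.start_mem_support
  | cons hxu q ih =>
    subst hr
    rw [SimpleGraph.Walk.support_cons, List.mem_cons] at hv hw
    rcases hv with rfl | hv
    · exact .inl (anc_of_mem_path hS hp (by simpa using hw))
    rcases hw with rfl | hw
    · exact .inr (anc_of_mem_path hS hp (by simp [hv]))
    exact ih rfl hp.of_cons hv hw

theorem anc_of_adj {a b : V} (hab : S.graph.Adj a b) :
    S.Anc a b ∨ S.Anc b a := by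
  obtain ⟨p, hp⟩ := exists_isPath hS b
  by_cases ha : a ∈ p.support
  · exact .inr (anc_of_mem_path hS hp ha)
  · refine .inl (anc_of_mem_path hS (p := .cons hab p) ?_ ?_)
    · exact (SimpleGraph.Walk.cons_isPath_iff _ _).2 ⟨hp, ha⟩
    · simp

/-- The descendant order. -/
@[reducible] def ancOrder : PartialOrder V where
  le := S.Anc
  le_refl v p := p.start_mem_support
  le_trans _ _ _ := anc_trans
  le_antisymm _ _ := anc_antisymm hS

/-- For an edge `a b` with `b` above `a`, anything strictly above `a` lies on the walk that goes to
`b` and then along the path from `b`, hence is above `b`. Conversely, if `b` covers `a`, the second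
vertex on the path from `a` lies between them and so is `b`. -/
theorem exists_treeOrder : ∃ _ : PartialOrder V, S.TreeOrder := by
  classical
  let _ := ancOrder hS
  refine ⟨ancOrder hS, ⟨fun v p => p.end_mem_support, fun h1 h2 => anc_chain hS h1 h2, ?_⟩⟩
  have covBy_of_adj : ∀ {a b : V}, S.graph.Adj a b → S.Anc a b → a ⋖ b := by
    intro a b hab h1
    refine ⟨lt_of_le_of_ne h1 hab.ne, fun c hac hcb => ?_⟩
    obtain ⟨p, hp⟩ := exists_isPath hS b
    have hc := hac.le (.cons hab p)
    rw [SimpleGraph.Walk.support_cons, List.mem_cons] at hc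
    rcases hc with rfl | hc
    · exact hac.ne rfl
    · exact hcb.not_ge (anc_of_mem_path hS hp hc)
  have adj_of_covBy : ∀ {a b : V}, a ⋖ b → S.graph.Adj a b := by
    intro a b hab
    obtain ⟨p, hp⟩ := exists_isPath hS a
    have hb : b ∈ p.support := hab.le p
    cases p with
    | nil =>
      rw [SimpleGraph.Walk.support_nil, List.mem_singleton] at hb
      exact absurd hb hab.ne'
    | @cons _ u _ hau q =>
      rw [SimpleGraph.Walk.support_cons, List.mem_cons] at hb
      have hb := hb.resolve_left hab.ne'
      have h1 : a ≤ u := anc_of_mem_path hS hp (by simp)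
      have h2 : u ≤ b := anc_of_mem_path hS hp.of_cons hb
      rcases hab.eq_or_eq h1 h2 with rfl | rfl
      · exact absurd rfl hau.ne
      · exact hau
  intro a b
  constructor
  · intro hab
    rcases anc_of_adj hS hab with h1 | h1
    · exact .inl (covBy_of_adj hab h1)
    · exact .inr (covBy_of_adj hab.symm h1)
  · rintro (h1 | h1)
    · exact adj_of_covBy h1
    · exact (adj_of_covBy h1).symm

end Path

end TreeOrder

/-! ### The label family and its invariance under reduction -/

section Family
variable {n : ℕ} {V W : Type}

open scoped Classical in
/-- The family of the nonempty sets of the labels that occur below a vertex of `S`. -/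
noncomputable def fam (S : RootedGraph n V) : Finset (Finset (Fin n)) :=
  Finset.univ.filter fun A => A.Nonempty ∧ ∃ v, ∀ i, i ∈ A ↔ S.Anc (S.label i) v

theorem mem_fam {S : RootedGraph n V} {A : Finset (Fin n)} :
    A ∈ S.fam ↔ A.Nonempty ∧ ∃ v, ∀ i, i ∈ A ↔ S.Anc (S.label i) v := by
  simp [fam]

theorem Iso.fam_eq {S : RootedGraph n V} {T : RootedGraph n W} (h : S.Iso T) :
    S.fam = T.fam := by
  obtain ⟨e, hl, hr⟩ := h
  ext A
  rw [mem_fam, mem_fam, e.toEquiv.exists_congr_left]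
  have : ∀ v i, S.Anc (S.label i) (e.symm v) ↔ T.Anc (T.label i) v := fun v i => by
    rw [← hl, ← anc_iff_of_iso e hr]
    simp
  refine and_congr_right fun _ => exists_congr fun v => forall_congr' fun i => ?_
  exact iff_congr Iff.rfl (this v i)

namespace TreeOrder
variable {S : RootedGraph n V} [PartialOrder V] (h : S.TreeOrder)
include h

theorem mem_fam_iff [Finite V] {A : Finset (Fin n)} :
    A ∈ S.fam ↔ A.Nonempty ∧ ∃ v, ∀ i, i ∈ A ↔ S.label i ≤ v := by
  simp [mem_fam, h.anc_iff]

/-- Deleting `v` creates new covering pairs only between children and parents of `v`; the chain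
condition makes all of these pairs covering. -/
theorem subtype_covBy_iff {v : V} {a b : {w // w ≠ v}} :
    a ⋖ b ↔ a.1 ⋖ b.1 ∨ (a.1 ⋖ v ∧ v ⋖ b.1) := by
  constructor
  · intro hab
    have hlt : a.1 < b.1 := hab.lt
    by_cases hv : a.1 < v ∧ v < b.1
    · refine .inr ⟨⟨hv.1, fun c h1 h2 => ?_⟩, ⟨hv.2, fun c h1 h2 => ?_⟩⟩
      · exact hab.2 (c := ⟨c, h2.ne⟩) h1 (h2.trans hv.2)
      · exact hab.2 (c := ⟨c, h1.ne'⟩) (hv.1.trans h1) h2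
    · refine .inl ⟨hlt, fun c h1 h2 => ?_⟩
      by_cases hc : c = v
      · exact hv ⟨lt_of_lt_of_eq h1 hc, lt_of_eq_of_lt hc.symm h2⟩
      · exact hab.2 (c := ⟨c, hc⟩) h1 h2
  · rintro (hab | ⟨h1, h2⟩)
    · exact ⟨hab.lt, fun c hac hcb => hab.2 (c := c.1) hac hcb⟩
    · refine ⟨h1.lt.trans h2.lt, fun c hac hcb => ?_⟩
      have hac' : a.1 < c.1 := hac
      have hcb' : c.1 < b.1 := hcb
      rcases h.chain hac'.le h1.le with h3 | h3
      · exact h1.2 hac' (lt_of_le_of_ne h3 c.2)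
      · exact h2.2 (lt_of_le_of_ne h3 c.2.symm) hcb'

/-- The labels below an unlabeled vertex are those below its children. With at most one child, the
set at `v` is either empty or already present at the child. All three reduction steps are of this
kind. -/
theorem fam_eq_of_subtype [Finite V] {v : V} (hv : S.Unlabeled v)
    (hsub : {c | c ⋖ v}.Subsingleton) {S' : RootedGraph n {w // w ≠ v}}
    (h' : S'.TreeOrder) (hl : ∀ i, (S'.label i).1 = S.label i) : S'.fam = S.fam := by
  ext A
  rw [h.mem_fam_iff, h'.mem_fam_iff]
  have hle : ∀ i (w : {w // w ≠ v}), S'.label i ≤ w ↔ S.label i ≤ w.1 := fun i w => by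
    rw [← hl]; rfl
  simp only [hle]
  refine and_congr_right fun hA => ⟨fun ⟨w, hw⟩ => ⟨w.1, hw⟩, fun ⟨w, hw⟩ => ?_⟩
  by_cases hwv : w = v
  · subst hwv
    have hlt : ∀ i, S.label i ≤ w → S.label i < w := fun i hi =>
      lt_of_le_of_ne hi fun he => hv ⟨i, he⟩
    obtain ⟨i, hi⟩ := hA
    obtain ⟨c, -, hc⟩ := exists_le_covBy_of_lt (hlt i ((hw i).1 hi))
    refine ⟨⟨c, hc.ne⟩, fun j => (hw j).trans ⟨fun hj => ?_, fun hj => hj.trans hc.le⟩⟩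
    obtain ⟨d, hjd, hd⟩ := exists_le_covBy_of_lt (hlt j hj)
    exact hjd.trans_eq (hsub hd hc)
  · exact ⟨⟨w, hwv⟩, hw⟩

theorem subtype_chain {v : V} {a b c : {w // w ≠ v}} (h1 : a ≤ b) (h2 : a ≤ c) :
    b ≤ c ∨ c ≤ b :=
  h.chain (a := a.1) (b := b.1) (c := c.1) h1 h2

theorem ncard_of_deg_two [Finite V] {v : V} (hr : S.root ≠ v) (hdeg : S.deg v = 2) :
    ∃ c, {c | c ⋖ v} = {c} := by
  rw [h.deg_of_ne_root hr.symm] at hdeg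
  rw [← Set.ncard_eq_one]
  omega

theorem children_of_deg_one [Finite V] {v : V} (hr : S.root ≠ v) (hdeg : S.deg v = 1) :
    {c | c ⋖ v} = ∅ := by
  rw [h.deg_of_ne_root hr.symm] at hdeg
  rw [← Set.ncard_eq_zero]
  omega

/-- Degree 2 means one child and one parent, so the only edge added joins exactly the new covering
pair. -/
theorem smooth [Finite V] {v : V} (hv : S.Unlabeled v) (hr : S.root ≠ v) (hdeg : S.deg v = 2) :
    (S.smooth v hv hr).TreeOrder := by
  obtain ⟨c, hc⟩ := h.ncard_of_deg_two hr hdeg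
  have hc' : ∀ x, x ⋖ v → x = c := fun x hx => by
    have : x ∈ {c | c ⋖ v} := hx
    rwa [hc] at this
  refine ⟨fun w => h.le_root w.1, h.subtype_chain, fun {a b} => ?_⟩
  rw [h.subtype_covBy_iff, h.subtype_covBy_iff]
  change a ≠ b ∧ (S.graph.Adj a.1 b.1 ∨ (S.graph.Adj a.1 v ∧ S.graph.Adj b.1 v)) ↔ _
  simp only [h.adj_iff]
  constructor
  · rintro ⟨hne, (h1 | h1) | ⟨h1 | h1, h2 | h2⟩⟩
    · exact .inl (.inl h1)
    · exact .inr (.inl h1)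
    · exact absurd (Subtype.ext ((hc' _ h1).trans (hc' _ h2).symm)) hne
    · exact .inl (.inr ⟨h1, h2⟩)
    · exact .inr (.inr ⟨h2, h1⟩)
    · exact absurd (Subtype.ext (h.covBy_unique h1 h2)) hne
  · rintro ((h1 | ⟨h1, h2⟩) | (h1 | ⟨h1, h2⟩))
    · exact ⟨fun he => h1.ne (congrArg _ he), .inl (.inl h1)⟩
    · exact ⟨fun he => (h1.lt.trans h2.lt).ne (congrArg _ he), .inr ⟨.inl h1, .inr h2⟩⟩
    · exact ⟨fun he => h1.ne' (congrArg _ he), .inl (.inr h1)⟩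
    · exact ⟨fun he => (h1.lt.trans h2.lt).ne' (congrArg _ he), .inr ⟨.inr h2, .inl h1⟩⟩

theorem pruneLeaf [Finite V] {v : V} (hv : S.Unlabeled v) (hr : S.root ≠ v)
    (hdeg : S.deg v = 1) : (S.prune v hv ⟨S.root, hr⟩).TreeOrder := by
  have hc : ∀ x, ¬ x ⋖ v := fun x hx => by
    have : x ∈ {c | c ⋖ v} := hx
    rwa [h.children_of_deg_one hr hdeg] at this
  refine ⟨fun w => h.le_root w.1, h.subtype_chain, fun {a b} => ?_⟩
  rw [h.subtype_covBy_iff, h.subtype_covBy_iff]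
  change S.graph.Adj a.1 b.1 ↔ _
  simp [h.adj_iff, hc]

theorem children_root_of_deg_one (hdeg : S.deg S.root = 1) {w : V}
    (hw : S.graph.Adj w S.root) : {c | c ⋖ S.root} = {w} := by
  have hwr : w ⋖ S.root := (h.adj_iff.1 hw).resolve_right fun hc => (h.le_root w).not_gt hc.lt
  rw [h.deg_root, Set.ncard_eq_one] at hdeg
  obtain ⟨c, hc⟩ := hdeg
  have : w ∈ {c | c ⋖ S.root} := hwr
  rw [hc] at this ⊢
  rw [this]

theorem pruneRoot [Finite V] (hv : S.Unlabeled S.root) (hdeg : S.deg S.root = 1) {w : V}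
    (hw : S.graph.Adj w S.root) : (S.prune S.root hv ⟨w, hw.ne⟩).TreeOrder := by
  have hc : ∀ x, ¬ S.root ⋖ x := fun x hx => (h.le_root x).not_gt hx.lt
  refine ⟨fun x => ?_, h.subtype_chain, fun {a b} => ?_⟩
  -- Everything below the old root is below its only child, the new root.
  · obtain ⟨c, hxc, hcr⟩ := exists_le_covBy_of_lt (lt_of_le_of_ne (h.le_root x.1) x.2)
    have : c ∈ {c | c ⋖ S.root} := hcr
    rw [h.children_root_of_deg_one hdeg hw] at this
    exact hxc.trans_eq this
  · rw [h.subtype_covBy_iff, h.subtype_covBy_iff]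
    change S.graph.Adj a.1 b.1 ↔ _
    simp [h.adj_iff, hc]

end TreeOrder

theorem ReducesTo.fam_eq {S : RootedGraph n V} {T : RootedGraph n W} (hST : S.ReducesTo T)
    (hV : Finite V) (hS : S.graph.IsTree) : T.fam = S.fam := by
  induction hST with
  | refl S => rfl
  | smooth v hv hr hdeg _ ih =>
    obtain ⟨_, h⟩ := exists_treeOrder hS
    have h' := h.smooth hv hr hdeg
    obtain ⟨c, hc⟩ := h.ncard_of_deg_two hr hdeg
    rw [ih inferInstance h'.isTree]
    exact h.fam_eq_of_subtype hv (hc ▸ Set.subsingleton_singleton) h' fun i => rfl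
  | pruneLeaf v hv hr hdeg _ ih =>
    obtain ⟨_, h⟩ := exists_treeOrder hS
    have h' := h.pruneLeaf hv hr hdeg
    rw [ih inferInstance h'.isTree]
    exact h.fam_eq_of_subtype hv
      (h.children_of_deg_one hr hdeg ▸ Set.subsingleton_empty) h' fun i => rfl
  | pruneRoot hv hdeg w hw _ ih =>
    obtain ⟨_, h⟩ := exists_treeOrder hS
    have h' := h.pruneRoot hv hdeg hw
    rw [ih inferInstance h'.isTree]
    exact h.fam_eq_of_subtype hv
      (h.children_root_of_deg_one hdeg hw ▸ Set.subsingleton_singleton) h' fun i => rfl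

/-- A failure of the Greg condition is an unlabeled vertex with at most one child, which one of the
three steps removes; the number of vertices drops. -/
theorem exists_reducesTo_isGreg (hn : 1 ≤ n) (N : ℕ) : ∀ {V : Type} [Finite V]
    (S : RootedGraph n V), S.graph.IsTree → Nat.card V = N →
    ∃ (W : Type) (_ : Finite W) (T : RootedGraph n W), S.ReducesTo T ∧ T.IsGreg := by
  induction N with
  | zero =>
    intro V _ S hS hV
    have : Nonempty V := ⟨S.root⟩
    exact absurd hV Nat.card_pos.ne'
  | succ N ih =>
    intro V _ S hS hV
    have hcard : ∀ v : V, Nat.card {w // w ≠ v} = N := fun v => by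
      classical
      have := Fintype.ofFinite V
      rw [Nat.card_eq_fintype_card] at hV ⊢
      rw [Fintype.card_subtype_compl, hV]
      simp
    obtain ⟨_, h⟩ := exists_treeOrder hS
    by_cases hG : S.IsGreg
    · exact ⟨V, inferInstance, S, .refl S, hG⟩
    rw [h.isGreg_iff] at hG
    push Not at hG
    obtain ⟨v, hv, hlt⟩ := hG
    by_cases hr : S.root = v
    · subst hr
      -- A labeled vertex exists since `1 ≤ n`; this excludes an isolated unlabeled root, to which
      -- no step applies.
      have hne : {c | c ⋖ S.root}.Nonempty := by
        have hlt : S.label ⟨0, hn⟩ < S.root :=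
          lt_of_le_of_ne (h.le_root _) fun he => hv ⟨_, he⟩
        obtain ⟨c, -, hc⟩ := exists_le_covBy_of_lt hlt
        exact ⟨c, hc⟩
      have hdeg : S.deg S.root = 1 := by
        rw [h.deg_root]
        have := hne.ncard_pos
        omega
      obtain ⟨w, hw⟩ := hne
      have hw : S.graph.Adj w S.root := h.adj_iff.2 (.inl hw)
      obtain ⟨W, hW, T, h1, h2⟩ := ih _ (h.pruneRoot hv hdeg hw).isTree (hcard _)
      exact ⟨W, hW, T, .pruneRoot hv hdeg w hw h1, h2⟩
    · have hdeg := h.deg_of_ne_root (Ne.symm hr)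
      have : S.deg v = 1 ∨ S.deg v = 2 := by omega
      rcases this with hdeg | hdeg
      · obtain ⟨W, hW, T, h1, h2⟩ := ih _ (h.pruneLeaf hv hr hdeg).isTree (hcard _)
        exact ⟨W, hW, T, .pruneLeaf v hv hr hdeg h1, h2⟩
      · obtain ⟨W, hW, T, h1, h2⟩ := ih _ (h.smooth hv hr hdeg).isTree (hcard _)
        exact ⟨W, hW, T, .smooth v hv hr hdeg h1, h2⟩

end Family
end RootedGraph

/-! ### Hierarchies, Greg trees and Cayley trees -/

section Hierarchy
variable {n : ℕ} {V W : Type}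

/-- Laminar families of nonempty sets that contain the whole set and separate its points. -/
structure IsHierarchy (F : Finset (Finset (Fin n))) : Prop where
  nonempty : ∀ A ∈ F, A.Nonempty
  univ_mem : Finset.univ ∈ F
  laminar : ∀ A ∈ F, ∀ B ∈ F, ∀ i ∈ A, i ∈ B → A ⊆ B ∨ B ⊆ A
  separates : ∀ i j, (∀ A ∈ F, i ∈ A ↔ j ∈ A) → i = j

namespace RootedGraph

theorem TreeOrder.isHierarchy [Finite V] {S : RootedGraph n V} [PartialOrder V]
    (h : S.TreeOrder) (hn : 1 ≤ n) : IsHierarchy S.fam where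
  nonempty A hA := (h.mem_fam_iff.1 hA).1
  univ_mem := h.mem_fam_iff.2
    ⟨⟨⟨0, hn⟩, Finset.mem_univ _⟩, S.root, fun i => by simp [h.le_root]⟩
  laminar A hA B hB i hiA hiB := by
    obtain ⟨-, v, hv⟩ := h.mem_fam_iff.1 hA
    obtain ⟨-, w, hw⟩ := h.mem_fam_iff.1 hB
    rcases h.chain ((hv i).1 hiA) ((hw i).1 hiB) with hvw | hvw
    · exact .inl fun j hj => (hw j).2 (((hv j).1 hj).trans hvw)
    · exact .inr fun j hj => (hv j).2 (((hw j).1 hj).trans hvw)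
  separates := by
    classical
    -- Test with the set of labels below the vertex labeled `i`.
    have key : ∀ i j, (∀ A ∈ S.fam, i ∈ A ↔ j ∈ A) → S.label j ≤ S.label i := by
      intro i j hij
      have := (hij (Finset.univ.filter fun l => S.label l ≤ S.label i)
        (h.mem_fam_iff.2 ⟨⟨i, by simp⟩, S.label i, fun l => by simp⟩)).1 (by simp)
      simpa using this
    intro i j hij
    exact S.label.injective
      (le_antisymm (key j i fun A hA => (hij A hA).symm) (key i j hij))

namespace TreeOrder
variable [Finite V] {S : RootedGraph n V} [PartialOrder V] (h : S.TreeOrder) (hG : S.IsGreg)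
include h hG

/-- A minimal vertex below `v` has no children, so the Greg condition forces it to carry a label. -/
theorem exists_label_le (v : V) : ∃ i, S.label i ≤ v := by
  obtain ⟨u, huv, hu⟩ := exists_minimal_le_of_wellFoundedLT (fun _ : V => True) v trivial
  by_contra hcon
  push Not at hcon
  have hlab : S.Unlabeled u := fun ⟨i, hi⟩ => hcon i (hi ▸ huv)
  have h2 := h.isGreg_iff.1 hG u hlab
  obtain ⟨c, hc⟩ := Set.nonempty_of_ncard_ne_zero (s := {c | c ⋖ u}) (by omega)
  exact (CovBy.lt hc).not_ge (hu.2 trivial (CovBy.le hc))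

/-- The label sets recover the order. If `w < v` and `v` is unlabeled, `v` has a child `d` other
than the child `c` above `w`; a label below `d` would also be below `c`, making two distinct
children comparable. -/
theorem le_of_forall_label {v w : V} (hvw : ∀ i, S.label i ≤ v → S.label i ≤ w) : v ≤ w := by
  obtain ⟨i, hi⟩ := h.exists_label_le hG v
  rcases h.chain hi (hvw i hi) with h1 | h1
  · exact h1
  rcases eq_or_lt_of_le h1 with h1 | h1
  · exact h1.ge
  by_cases hv : S.Unlabeled v
  · obtain ⟨c, hwc, hcv⟩ := exists_le_covBy_of_lt h1
    have h2 : 1 < {c | c ⋖ v}.ncard := h.isGreg_iff.1 hG v hv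
    obtain ⟨d, hd, hdc⟩ := Set.exists_ne_of_one_lt_ncard h2 c
    have hdv : d ⋖ v := hd
    obtain ⟨j, hj⟩ := h.exists_label_le hG d
    have hjc := (hvw j (hj.trans hdv.le)).trans hwc
    rcases h.chain hj hjc with h3 | h3
    · exact absurd ((hdv.eq_or_eq h3 hcv.le).resolve_right hcv.ne).symm hdc
    · exact absurd ((hcv.eq_or_eq h3 hdv.le).resolve_right hdv.ne) hdc
  · obtain ⟨j, rfl⟩ := not_not.1 hv
    exact hvw j le_rfl

theorem exists_orderIso :
    ∃ e : V ≃o {A // A ∈ S.fam}, ∀ v i, i ∈ (e v).1 ↔ S.label i ≤ v := by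
  classical
  let f : V → {A // A ∈ S.fam} := fun v =>
    ⟨Finset.univ.filter fun i => S.label i ≤ v, h.mem_fam_iff.2 ⟨by
      obtain ⟨i, hi⟩ := h.exists_label_le hG v
      exact ⟨i, by simpa using hi⟩, v, fun i => by simp⟩⟩
  have hf : ∀ v i, i ∈ (f v).1 ↔ S.label i ≤ v := fun v i => by simp [f]
  have hle : ∀ v w, f v ≤ f w ↔ v ≤ w := fun v w =>
    ⟨fun hvw => h.le_of_forall_label hG fun i hi => (hf w i).1 (hvw ((hf v i).2 hi)),
      fun hvw i hi => (hf w i).2 (((hf v i).1 hi).trans hvw)⟩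
  have hsurj : Function.Surjective f := by
    rintro ⟨A, hA⟩
    obtain ⟨-, v, hv⟩ := h.mem_fam_iff.1 hA
    refine ⟨v, Subtype.ext ?_⟩
    ext i
    rw [hf, hv]
  let emb : V ↪o {A // A ∈ S.fam} := OrderEmbedding.ofMapLEIff f hle
  exact ⟨RelIso.ofSurjective emb hsurj, hf⟩

end TreeOrder

/-- Both trees are order isomorphic to the same family under inclusion. Order determines the rest:
edges are covering pairs, the root is the top, and label `i` sits at the least vertex whose set
contains `i`. -/
theorem IsGreg.iso_of_fam_eq [Finite V] [Finite W] {S : RootedGraph n V} {T : RootedGraph n W}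
    (hS : S.IsGreg) (hT : T.IsGreg) (hST : S.fam = T.fam) : S.Iso T := by
  obtain ⟨_, h⟩ := exists_treeOrder hS.1
  obtain ⟨_, k⟩ := exists_treeOrder hT.1
  obtain ⟨e, he⟩ := h.exists_orderIso hS
  obtain ⟨f, hf⟩ := k.exists_orderIso hT
  generalize T.fam = F at hST f hf
  generalize S.fam = G at hST e he
  subst hST
  let g := e.trans f.symm
  have hg : ∀ i v, T.label i ≤ g v ↔ S.label i ≤ v := fun i v => by
    rw [← hf, ← he]
    simp [g]
  refine ⟨⟨g.toEquiv, fun {a b} => ?_⟩, fun i => ?_, ?_⟩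
  · rw [k.adj_iff, h.adj_iff]
    exact or_congr (apply_covBy_apply_iff g) (apply_covBy_apply_iff g)
  · change g (S.label i) = T.label i
    refine le_antisymm ?_ ((hg i _).2 le_rfl)
    rw [← g.le_symm_apply, ← hg, g.apply_symm_apply]
  · exact le_antisymm (k.le_root _) (g.symm_apply_le.1 (h.le_root _))

theorem IsGreg.unl_add [Finite V] {S : RootedGraph n V} (hS : S.IsGreg) :
    S.unl + n = S.fam.card := by
  obtain ⟨_, h⟩ := exists_treeOrder hS.1
  obtain ⟨e, -⟩ := h.exists_orderIso hS
  have h1 : Nat.card V = S.fam.card := by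
    rw [Nat.card_congr e.toEquiv]
    simp
  have h2 : (Set.range S.label).ncard = n := by
    rw [← Set.image_univ, Set.ncard_image_of_injective _ S.label.injective, Set.ncard_univ]
    simp
  have h3 := Set.ncard_add_ncard_compl (Set.range S.label)
  have h4 : {v | S.Unlabeled v} = (Set.range S.label)ᶜ := rfl
  rw [unl, h4]
  omega

theorem Iso.deg_eq {S : RootedGraph n V} {T : RootedGraph n W} (e : S.graph ≃g T.graph) (v : V) :
    T.deg (e v) = S.deg v :=
  (Nat.card_congr (e.mapNeighborSet v)).symm

theorem Iso.isGreg {S : RootedGraph n V} {T : RootedGraph n W} (h : S.Iso T) (hS : S.IsGreg) :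
    T.IsGreg := by
  obtain ⟨e, hl, hr⟩ := h
  refine ⟨e.isTree_iff.1 hS.1, fun w hw => ?_⟩
  obtain ⟨v, rfl⟩ := e.surjective w
  have hv : S.Unlabeled v := fun ⟨i, hi⟩ => hw ⟨i, by rw [← hl, hi]⟩
  rw [Iso.deg_eq, ← hr]
  exact ⟨(hS.2 v hv).1, fun hne => (hS.2 v hv).2 fun h => hne (congrArg e h)⟩

/-- Transport along a bijection of the vertices. -/
def relabel (S : RootedGraph n V) (e : V ≃ W) : RootedGraph n W where
  graph := S.graph.comap e.symm
  label := S.label.trans e.toEmbedding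
  root := e S.root

theorem iso_relabel (S : RootedGraph n V) (e : V ≃ W) : S.Iso (S.relabel e) :=
  ⟨⟨e, by simp [relabel]⟩, fun _ => rfl, rfl⟩

theorem exists_gregRep [Finite V] {S : RootedGraph n V} (hS : S.IsGreg) :
    ∃ R : GregRep n, S.Iso R.2.1 := by
  have := Fintype.ofFinite V
  have h := S.iso_relabel (Fintype.equivFin V)
  exact ⟨⟨Fintype.card V, _, h.isGreg hS⟩, h⟩

end RootedGraph

namespace IsHierarchy
variable {F : Finset (Finset (Fin n))} (hF : IsHierarchy F)
include hF

/-- By laminarity the members containing `i` form a chain. -/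
theorem exists_least (i : Fin n) : ∃ A ∈ F, i ∈ A ∧ ∀ B ∈ F, i ∈ B → A ⊆ B := by
  obtain ⟨A, hA⟩ := (F.filter (i ∈ ·)).exists_minimal
    ⟨Finset.univ, by simp [hF.univ_mem]⟩
  have hA1 := Finset.mem_filter.1 hA.1
  refine ⟨A, hA1.1, hA1.2, fun B hB hiB => ?_⟩
  rcases hF.laminar A hA1.1 B hB i hA1.2 hiB with h | h
  · exact h
  · exact hA.2 (Finset.mem_filter.2 ⟨hB, hiB⟩) h

/-- The smallest member that contains a given point. -/
noncomputable def least (i : Fin n) : {A // A ∈ F} :=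
  ⟨(hF.exists_least i).choose, (hF.exists_least i).choose_spec.1⟩

theorem least_le_iff (i : Fin n) (A : {A // A ∈ F}) : hF.least i ≤ A ↔ i ∈ A.1 :=
  ⟨fun h => h (hF.exists_least i).choose_spec.2.1,
    fun h => (hF.exists_least i).choose_spec.2.2 A.1 A.2 h⟩

theorem least_injective : Function.Injective hF.least := by
  intro i j hij
  refine hF.separates i j fun A hA => ?_
  rw [← hF.least_le_iff i ⟨A, hA⟩, hij, hF.least_le_iff]

/-- The rooted tree whose vertices are the members of a hierarchy. -/
noncomputable def toRootedGraph : RootedGraph n {A // A ∈ F} where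
  graph := SimpleGraph.hasse _
  label := ⟨hF.least, hF.least_injective⟩
  root := ⟨Finset.univ, hF.univ_mem⟩

theorem treeOrder_toRootedGraph : hF.toRootedGraph.TreeOrder where
  le_root A := Finset.subset_univ A.1
  chain {A B C} hAB hAC := by
    obtain ⟨i, hi⟩ := hF.nonempty A.1 A.2
    exact hF.laminar B.1 B.2 C.1 C.2 i (hAB hi) (hAC hi)
  adj_iff := SimpleGraph.hasse_adj

theorem fam_toRootedGraph : hF.toRootedGraph.fam = F := by
  ext A
  have hl : ∀ i B, hF.toRootedGraph.label i ≤ B ↔ i ∈ B.1 := hF.least_le_iff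
  rw [hF.treeOrder_toRootedGraph.mem_fam_iff]
  simp only [hl, ← Finset.ext_iff]
  exact ⟨fun ⟨_, B, hB⟩ => hB ▸ B.2, fun hA => ⟨hF.nonempty A hA, ⟨A, hA⟩, rfl⟩⟩

/-- If `A` is not the least member of any of its points, each point lies in a child of `A`. A child
`B` is a proper subset, so a point of `A` outside `B` gives a second child. -/
theorem isGreg_toRootedGraph : hF.toRootedGraph.IsGreg := by
  rw [hF.treeOrder_toRootedGraph.isGreg_iff]
  intro A hA
  have hlt : ∀ i ∈ A.1, hF.least i < A := fun i hi =>
    lt_of_le_of_ne ((hF.least_le_iff i A).2 hi) fun he => hA ⟨i, he⟩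
  obtain ⟨i, hi⟩ := hF.nonempty A.1 A.2
  obtain ⟨B, hiB, hB⟩ := exists_le_covBy_of_lt (hlt i hi)
  obtain ⟨j, hj, hjB⟩ := Finset.exists_of_ssubset (show B.1 ⊂ A.1 from hB.lt)
  obtain ⟨C, hjC, hC⟩ := exists_le_covBy_of_lt (hlt j hj)
  change 1 < _
  rw [Set.one_lt_ncard]
  refine ⟨B, hB, C, hC, fun hBC => hjB ?_⟩
  rw [hBC]
  exact (hF.least_le_iff j C).1 hjC

end IsHierarchy

/-- The family of the sets of labels below the vertices of a rooted Greg tree. -/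
noncomputable def RootedGregTree.fam (T : RootedGregTree n) : Finset (Finset (Fin n)) :=
  Quotient.lift (fun S : GregRep n => S.2.1.fam) (fun _ _ h => RootedGraph.Iso.fam_eq h) T

theorem RootedGregTree.fam_injective : Function.Injective (RootedGregTree.fam (n := n)) := by
  intro S T hST
  induction S using Quotient.ind
  induction T using Quotient.ind
  exact Quotient.sound (RootedGraph.IsGreg.iso_of_fam_eq (Subtype.prop _) (Subtype.prop _) hST)

theorem RootedGregTree.pos (T : RootedGregTree n) : 1 ≤ n := by
  induction T using Quotient.ind with
  | _ S =>
    have h1 := S.card_le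
    have h2 := S.2.1.root.pos
    omega

theorem RootedGregTree.isHierarchy (T : RootedGregTree n) : IsHierarchy T.fam := by
  have hn := T.pos
  induction T using Quotient.ind with
  | _ S =>
    obtain ⟨_, h⟩ := RootedGraph.exists_treeOrder S.2.2.1
    exact h.isHierarchy hn

theorem RootedGregTree.unl_add (T : RootedGregTree n) : T.unl + n = T.fam.card := by
  induction T using Quotient.ind with
  | _ S => exact S.2.2.unl_add

theorem IsHierarchy.exists_fam_eq {F : Finset (Finset (Fin n))} (hF : IsHierarchy F) :
    ∃ T : RootedGregTree n, T.fam = F := by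
  obtain ⟨R, hR⟩ := RootedGraph.exists_gregRep hF.isGreg_toRootedGraph
  exact ⟨Quotient.mk _ R, hR.fam_eq.symm.trans hF.fam_toRootedGraph⟩

/-! ### Restriction of Cayley trees as the trace of hierarchies -/

namespace RootedCayleyTree
variable {m : ℕ}

/-- Reductions may be done in any order because the family is invariant and determines the resulting
Greg tree. This replaces the reduction process by an equality of families. -/
theorem restrictsTo_iff (hn : 1 ≤ n) (hnm : n ≤ m) (X : RootedCayleyTree m)
    (T : RootedGregTree n) : X.RestrictsTo hnm T ↔ T.fam = (X.forget hnm).fam := by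
  constructor
  · rintro ⟨W, S, R, hXS, hSR, rfl⟩
    exact hSR.fam_eq.symm.trans (hXS.fam_eq inferInstance X.2)
  · intro h
    obtain ⟨W, _, S, hXS, hS⟩ :=
      RootedGraph.exists_reducesTo_isGreg hn _ (X.forget hnm) X.2 rfl
    obtain ⟨R, hR⟩ := RootedGraph.exists_gregRep hS
    refine ⟨W, S, R, hXS, hR, RootedGregTree.fam_injective ?_⟩
    rw [h, ← hXS.fam_eq inferInstance X.2]
    exact hR.fam_eq.symm

/-- The family of the sets of descendants of the vertices of a rooted Cayley tree. -/
noncomputable def fam (X : RootedCayleyTree m) : Finset (Finset (Fin m)) :=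
  (X.forget le_rfl).fam

theorem isGreg_forget (X : RootedCayleyTree m) : (X.forget le_rfl).IsGreg :=
  ⟨X.2, fun v hv => absurd ⟨v, rfl⟩ hv⟩

theorem fam_injective : Function.Injective (fam (m := m)) := by
  intro X Y h
  obtain ⟨e, hl, hr⟩ := X.isGreg_forget.iso_of_fam_eq Y.isGreg_forget h
  have he : ∀ v, e v = v := hl
  refine Subtype.ext (Prod.ext ?_ ((he _).symm.trans hr))
  ext v w
  have := e.map_adj_iff (v := v) (w := w)
  rw [he, he] at this
  exact this.symm

theorem isHierarchy_fam (X : RootedCayleyTree m) : IsHierarchy X.fam := by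
  obtain ⟨_, h⟩ := RootedGraph.exists_treeOrder X.isGreg_forget.1
  exact h.isHierarchy X.1.2.pos

theorem card_fam (X : RootedCayleyTree m) : X.fam.card = m := by
  have h : (X.forget le_rfl).unl = 0 := by
    rw [RootedGraph.unl, Set.ncard_eq_zero]
    ext v
    simp only [Set.mem_ofPred_eq, Set.mem_empty_iff_false, iff_false]
    exact fun hv => hv ⟨v, rfl⟩
  rw [fam, ← X.isGreg_forget.unl_add, h, zero_add]

/-- With `m` members the injection `least` is bijective, so every vertex of the Hasse tree carries a
label and can be renamed by it. -/
theorem _root_.GregTree.IsHierarchy.exists_cayley_fam_eq {F : Finset (Finset (Fin m))}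
    (hF : IsHierarchy F) (hc : F.card = m) : ∃ X : RootedCayleyTree m, X.fam = F := by
  have hbij : Function.Bijective hF.least := by
    rw [Fintype.bijective_iff_injective_and_card]
    exact ⟨hF.least_injective, by simp [hc]⟩
  let e : {A // A ∈ F} ≃ Fin m := (Equiv.ofBijective _ hbij).symm
  have hiso := hF.toRootedGraph.iso_relabel e
  have hG := hiso.isGreg hF.isGreg_toRootedGraph
  let X : RootedCayleyTree m :=
    ⟨((hF.toRootedGraph.relabel e).graph, (hF.toRootedGraph.relabel e).root), hG.1⟩
  refine ⟨X, ?_⟩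
  have hX : X.forget le_rfl = hF.toRootedGraph.relabel e := by
    have : (X.forget le_rfl).label = (hF.toRootedGraph.relabel e).label := by
      ext i
      exact congrArg Fin.val (Equiv.symm_apply_apply (Equiv.ofBijective _ hbij) i).symm
    rw [RootedGraph.mk.injEq]
    exact ⟨rfl, this, rfl⟩
  rw [fam, hX, ← hiso.fam_eq, hF.fam_toRootedGraph]

end RootedCayleyTree

/-- The nonempty traces of the members of `F` on the first `n` points. -/
def restrictFam {m : ℕ} (hnm : n ≤ m) (F : Finset (Finset (Fin m))) : Finset (Finset (Fin n)) :=
  (F.image fun A => Finset.univ.filter fun i => Fin.castLE hnm i ∈ A).erase ∅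

theorem mem_restrictFam {m : ℕ} {hnm : n ≤ m} {F : Finset (Finset (Fin m))}
    {A : Finset (Fin n)} :
    A ∈ restrictFam hnm F ↔ A.Nonempty ∧ ∃ B ∈ F, ∀ i, i ∈ A ↔ Fin.castLE hnm i ∈ B := by
  simp [restrictFam, Finset.nonempty_iff_ne_empty, Finset.ext_iff, iff_comm]

theorem restrictFam_restrictFam {l m : ℕ} (hnl : n ≤ l) (hlm : l ≤ m)
    (F : Finset (Finset (Fin m))) :
    restrictFam hnl (restrictFam hlm F) = restrictFam (hnl.trans hlm) F := by
  ext A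
  simp only [mem_restrictFam]
  refine and_congr_right fun hA => ?_
  constructor
  · rintro ⟨B, ⟨-, C, hC, hBC⟩, hAB⟩
    exact ⟨C, hC, fun i => by rw [hAB, hBC]; rfl⟩
  · rintro ⟨C, hC, hAC⟩
    refine ⟨Finset.univ.filter fun i => Fin.castLE hlm i ∈ C, ⟨?_, C, hC, by simp⟩,
      fun i => by rw [hAC]; simp⟩
    obtain ⟨i, hi⟩ := hA
    exact ⟨Fin.castLE hnl i, by simpa using (hAC i).1 hi⟩

theorem RootedCayleyTree.fam_forget {m : ℕ} (hnm : n ≤ m) (X : RootedCayleyTree m) :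
    (X.forget hnm).fam = restrictFam hnm X.fam := by
  classical
  ext A
  rw [RootedGraph.mem_fam, mem_restrictFam]
  refine and_congr_right fun ⟨i, hi⟩ => ⟨fun ⟨v, hv⟩ => ?_, fun ⟨B, hB, hAB⟩ => ?_⟩
  · let B := Finset.univ.filter fun j => (X.forget le_rfl).Anc j v
    have hB : ∀ i, i ∈ A ↔ Fin.castLE hnm i ∈ B := fun i => by
      rw [hv, Finset.mem_filter]
      exact (and_iff_right (Finset.mem_univ _)).symm
    exact ⟨B, RootedGraph.mem_fam.2 ⟨⟨_, (hB i).1 hi⟩, v, fun j => by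
      rw [Finset.mem_filter]; exact and_iff_right (Finset.mem_univ _)⟩, hB⟩
  · obtain ⟨-, v, hv⟩ := RootedGraph.mem_fam.1 hB
    exact ⟨v, fun i => (hAB i).trans (hv _)⟩

end Hierarchy

/-! ### The tree function and the series of the proposition -/

section Series
open Polynomial in
-- Induction on `k`: the derivative of the identity for `k + 1` is `k + 1` times the one for `k`
-- shifted by `X ↦ X + 1`. The constant is fixed at `X = -(k + 2)`, where the right side vanishes
-- and the left is a `(k + 1)`-st finite difference of `x ^ k`.
theorem abel_identity (k : ℕ) :
    ∑ j ∈ Finset.range (k + 1), C ((k.choose j : ℚ) * ((j : ℚ) + 1) ^ (j - 1)) *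
      (X + C ((k - j : ℕ) : ℚ)) ^ (k - j) = (X + C ((k : ℚ) + 1)) ^ k := by
  induction k with
  | zero => simp
  | succ k ih =>
    have hd : derivative (∑ j ∈ Finset.range (k + 1 + 1),
        C (((k + 1).choose j : ℚ) * ((j : ℚ) + 1) ^ (j - 1)) *
          (X + C ((k + 1 - j : ℕ) : ℚ)) ^ (k + 1 - j)) =
        derivative ((X + C (((k + 1 : ℕ) : ℚ) + 1)) ^ (k + 1)) := by
      have ih' := congrArg (fun p : ℚ[X] => C ((k : ℚ) + 1) * p.comp (X + 1)) ih
      simp only [Polynomial.sum_comp, Finset.mul_sum] at ih'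
      rw [derivative_sum, Finset.sum_range_succ]
      simp only [derivative_mul, derivative_C, derivative_X_add_C_pow, zero_mul, zero_add]
      have e2 : C ((k + 1 : ℕ) : ℚ) * (X + C (((k + 1 : ℕ) : ℚ) + 1)) ^ (k + 1 - 1) =
          C ((k : ℚ) + 1) * ((X + C ((k : ℚ) + 1)) ^ k).comp (X + 1) := by
        have e : (X + C ((k : ℚ) + 1)).comp (X + 1) = X + C (((k + 1 : ℕ) : ℚ) + 1) := by
          simp; ring
        rw [pow_comp, e]
        simp
      rw [e2, ← ih']
      simp only [Nat.sub_self, Nat.cast_zero, C_0, zero_mul, mul_zero, add_zero]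
      refine Finset.sum_congr rfl fun j hj => ?_
      have hj : j ≤ k := by simpa [Nat.lt_succ_iff] using hj
      have e3 : k + 1 - j = k - j + 1 := by omega
      have e4 : (((k + 1).choose j : ℕ) : ℚ) * ((k - j + 1 : ℕ) : ℚ) =
          ((k : ℚ) + 1) * (k.choose j : ℚ) := by
        have := Nat.choose_mul_succ_eq k j
        rw [e3] at this
        have : (((k.choose j) * (k + 1) : ℕ) : ℚ) = (((k + 1).choose j * (k - j + 1) : ℕ) : ℚ) := by
          rw [this]
        push_cast at this ⊢
        linarith
      rw [e3, Nat.add_sub_cancel]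
      simp only [mul_comp, C_comp, pow_comp, add_comp, X_comp]
      have e5 : (X + C ((k - j + 1 : ℕ) : ℚ)) = (X + 1 + C ((k - j : ℕ) : ℚ)) := by
        push_cast; simp; ring
      rw [e5, ← mul_assoc, ← mul_assoc, ← C_mul, ← C_mul]
      congr 2
      linear_combination ((j : ℚ) + 1) ^ (j - 1) * e4
    have hz := sub_eq_zero.2 hd
    rw [← derivative_sub] at hz
    have hC := eq_C_of_derivative_eq_zero hz
    have he := congrArg (eval (-((k : ℚ) + 2))) hC
    have hval : ∑ j ∈ Finset.range (k + 1 + 1),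
        ((k + 1).choose j : ℚ) * ((j : ℚ) + 1) ^ (j - 1) *
          (-((k : ℚ) + 2) + ((k + 1 - j : ℕ) : ℚ)) ^ (k + 1 - j) = 0 := by
      have h := congrFun (fwdDiff_iter_pow_eq_zero_of_lt (R := ℚ) (Nat.lt_succ_self k)) 1
      rw [fwdDiff_iter_eq_sum_shift] at h
      rw [Pi.zero_apply] at h
      rw [← h]
      refine Finset.sum_congr rfl fun j hj => ?_
      have hj : j ≤ k + 1 := by simpa [Nat.lt_succ_iff] using hj
      have e1 : (-((k : ℚ) + 2) + ((k + 1 - j : ℕ) : ℚ)) = (-1) * ((j : ℚ) + 1) := by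
        rw [Nat.cast_sub hj]; push_cast; ring
      rw [e1, mul_pow]
      simp only [zsmul_eq_mul, nsmul_eq_mul]
      push_cast
      -- At `j = 0` the exponent `j - 1` truncates to 0, so the exponents do not add up to `k`;
      -- harmless, as the base is 1.
      rcases Nat.eq_zero_or_pos j with rfl | hj0
      · simp
      · have e2 : ((j : ℚ) + 1) ^ k = ((j : ℚ) + 1) ^ (j - 1) * ((j : ℚ) + 1) ^ (k + 1 - j) := by
          rw [← pow_add]; congr 1; omega
        rw [mul_one, add_comm (1 : ℚ), e2]
        ring
    have e6 : (-((k : ℚ) + 2) + (((k + 1 : ℕ) : ℚ) + 1)) = 0 := by push_cast; ring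
    simp only [eval_sub, eval_finsetSum, eval_mul, eval_C, eval_pow, eval_add, eval_X, hval, e6,
      zero_sub, ne_eq, Nat.add_eq_zero_iff, one_ne_zero, and_false, not_false_eq_true, zero_pow,
      neg_zero] at he
    rw [← he, C_0, sub_eq_zero] at hC
    exact hC

open PowerSeries

theorem constantCoeff_treeFunction : constantCoeff treeFunction = 0 := by
  simp [treeFunction, ← coeff_zero_eq_constantCoeff_apply]

theorem hasSubst_mul_treeFunction (n : ℕ) :
    HasSubst ((n : PowerSeries ℚ) * treeFunction) :=
  HasSubst.of_constantCoeff_zero' (by simp [constantCoeff_treeFunction])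

theorem constantCoeff_expTree (n : ℕ) : constantCoeff (expTree n) = 1 := by
  have h : PowerSeries.exp ℚ = (PowerSeries.exp ℚ - 1) + C 1 := by simp
  rw [expTree, h, subst_add (hasSubst_mul_treeFunction n), map_add]
  have h0 : constantCoeff ((PowerSeries.exp ℚ - 1).subst ((n : PowerSeries ℚ) * treeFunction)) = 0 :=
    constantCoeff_subst_eq_zero (by
      have : constantCoeff ((n : PowerSeries ℚ) * treeFunction) = 0 := by
        simp [constantCoeff_treeFunction]
      exact this) _ (by simp)
  rw [h0, subst_C, zero_add]
  exact MvPowerSeries.constantCoeff_C _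

theorem derivative_expTree (n : ℕ) :
    derivative ℚ (expTree n) = n * expTree n * derivative ℚ treeFunction := by
  rw [expTree, derivative_subst (hasSubst_mul_treeFunction n), derivative_exp]
  simp [Derivation.leibniz]
  ring

/-- `∑ (k + 1) ^ (k - 1) z ^ k / k!` -/
noncomputable def forestSeries : PowerSeries ℚ :=
  PowerSeries.mk fun k => ((k : ℚ) + 1) ^ (k - 1) / (k.factorial : ℚ)

theorem treeFunction_eq : treeFunction = X * forestSeries := by
  ext k
  cases k with
  | zero => simp [treeFunction]
  | succ k =>
    rw [coeff_succ_X_mul, treeFunction, forestSeries, coeff_mk, coeff_mk]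
    cases k with
    | zero => simp
    | succ k =>
      simp [Nat.factorial_succ]
      field_simp
      ring

theorem coeff_derivative_treeFunction (k : ℕ) :
    coeff k (derivative ℚ treeFunction) = ((k : ℚ) + 1) ^ k / k.factorial := by
  rw [coeff_derivative, treeFunction, coeff_mk]
  simp [Nat.factorial_succ]
  field_simp

/-- Coefficientwise this is `abel_identity` at `X = 1`. -/
theorem derivative_forestSeries :
    derivative ℚ forestSeries = forestSeries * derivative ℚ treeFunction := by
  ext k
  rw [coeff_mul, Finset.Nat.sum_antidiagonal_eq_sum_range_succ_mk]
  have h := congrArg (Polynomial.eval 1) (abel_identity k)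
  simp only [Polynomial.eval_finsetSum, Polynomial.eval_mul, Polynomial.eval_C, Polynomial.eval_pow,
    Polynomial.eval_add, Polynomial.eval_X] at h
  have e : coeff k (derivative ℚ forestSeries) = (1 + ((k : ℚ) + 1)) ^ k / k.factorial := by
    rw [coeff_derivative, forestSeries, coeff_mk]
    simp [Nat.factorial_succ]
    field_simp
    ring
  rw [e, ← h, Finset.sum_div]
  refine Finset.sum_congr rfl fun j hj => ?_
  have hj : j ≤ k := by simpa [Nat.lt_succ_iff] using hj
  rw [coeff_derivative_treeFunction, forestSeries, coeff_mk, Nat.cast_choose ℚ hj, add_comm (1 : ℚ)]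
  have := Nat.factorial_ne_zero k
  field_simp

/-- Both sides solve `y' = y T'` with constant term 1, so their quotient has derivative zero. With
`treeFunction_eq` this is `T = z e^T`. -/
theorem expTree_one : expTree 1 = forestSeries := by
  have hc : constantCoeff (expTree 1) ≠ 0 := by simp [constantCoeff_expTree]
  have h : forestSeries * (expTree 1)⁻¹ = 1 := by
    refine derivative.ext ?_ ?_
    · simp only [Derivation.leibniz, derivative_inv', derivative_forestSeries, derivative_expTree,
        derivative_one, smul_eq_mul]
      linear_combination (-forestSeries * (expTree 1)⁻¹ * derivative ℚ treeFunction) *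
        PowerSeries.mul_inv_cancel _ hc
    · have : constantCoeff forestSeries = 1 := by
        rw [← coeff_zero_eq_constantCoeff_apply, forestSeries, coeff_mk]
        simp
      simp [constantCoeff_expTree, this]
  linear_combination -expTree 1 * h + forestSeries * PowerSeries.mul_inv_cancel _ hc

theorem constantCoeff_one_sub_treeFunction : constantCoeff (1 - treeFunction) ≠ 0 := by
  simp [constantCoeff_treeFunction]

theorem derivative_treeFunction :
    derivative ℚ treeFunction = expTree 1 * (1 - treeFunction)⁻¹ := by
  rw [PowerSeries.eq_mul_inv_iff_mul_eq constantCoeff_one_sub_treeFunction]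
  have h := congrArg (derivative ℚ) treeFunction_eq
  simp only [Derivation.leibniz, derivative_forestSeries, derivative_X, smul_eq_mul] at h
  rw [expTree_one]
  linear_combination h - derivative ℚ treeFunction * treeFunction_eq

theorem expTree_succ (n : ℕ) : expTree (n + 1) = expTree n * expTree 1 := by
  have hn : constantCoeff (expTree n) ≠ 0 := by simp [constantCoeff_expTree]
  have h1 : constantCoeff (expTree 1) ≠ 0 := by simp [constantCoeff_expTree]
  have hc : constantCoeff (expTree n * expTree 1) ≠ 0 := by simp [constantCoeff_expTree]
  have h : expTree (n + 1) * (expTree n * expTree 1)⁻¹ = 1 := by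
    refine derivative.ext ?_ ?_
    · simp only [Derivation.leibniz, derivative_inv', derivative_expTree,
        derivative_one, smul_eq_mul, Nat.cast_add, Nat.cast_one]
      linear_combination (-((n : PowerSeries ℚ) + 1) * expTree (n + 1) *
        (expTree n * expTree 1)⁻¹ * derivative ℚ treeFunction) * PowerSeries.mul_inv_cancel _ hc
    · simp [constantCoeff_expTree]
  linear_combination (expTree n * expTree 1) * h -
    expTree (n + 1) * PowerSeries.mul_inv_cancel _ hc

/-- The series `e^{n T} (1 - T)^{-n} (T / (1 - T))^u`. -/
noncomputable def gregSeries (n u : ℕ) : PowerSeries ℚ :=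
  expTree n * ((1 - treeFunction)⁻¹) ^ n * (treeFunction * (1 - treeFunction)⁻¹) ^ u

theorem constantCoeff_gregSeries (n u : ℕ) :
    constantCoeff (gregSeries n u) = if u = 0 then 1 else 0 := by
  simp [gregSeries, constantCoeff_expTree, constantCoeff_treeFunction, zero_pow_eq]

/-- Put `y = T/(1-T)`. Then `1/(1-T) = 1 + y`, `T' = e^T (1+y)` and `y' = (1+y)^2 T'`. The product
rule leaves the factor `n y^u (2+y) + u y^(u-1) (1+y)^2`, whose expansion gives the three
coefficients. -/
theorem derivative_gregSeries (n u : ℕ) :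
    derivative ℚ (gregSeries n u) = u * gregSeries (n + 1) (u - 1) +
      2 * (n + u) * gregSeries (n + 1) u + (n + u) * gregSeries (n + 1) (u + 1) := by
  have hi := PowerSeries.mul_inv_cancel _ constantCoeff_one_sub_treeFunction
  have hJ : derivative ℚ ((1 - treeFunction)⁻¹ ^ n) =
      n * (1 - treeFunction)⁻¹ ^ (n + 1) * derivative ℚ treeFunction := by
    rw [derivative_pow, derivative_inv']
    cases n with
    | zero => simp
    | succ n => simp; ring
  have hy : derivative ℚ (treeFunction * (1 - treeFunction)⁻¹) =
      (1 - treeFunction)⁻¹ ^ 2 * derivative ℚ treeFunction := by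
    simp only [Derivation.leibniz, derivative_inv', smul_eq_mul, map_sub, derivative_one]
    linear_combination (-(1 - treeFunction)⁻¹ * derivative ℚ treeFunction) * hi
  have hyJ : (1 - treeFunction)⁻¹ = 1 + treeFunction * (1 - treeFunction)⁻¹ := by
    linear_combination hi
  unfold gregSeries
  rw [Derivation.leibniz, Derivation.leibniz, derivative_pow, hJ, hy, derivative_expTree,
    expTree_succ, derivative_treeFunction]
  simp only [smul_eq_mul]
  generalize treeFunction * (1 - treeFunction)⁻¹ = y at *
  rw [hyJ]
  cases u with
  | zero => simp; ring
  | succ u => simp; ring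
end Series

/-! ### Inserting one point into a hierarchy -/

section Fiber
variable {n : ℕ}

theorem IsHierarchy.restrict {m : ℕ} {F : Finset (Finset (Fin m))} (hF : IsHierarchy F)
    (hn : 1 ≤ n) (hnm : n ≤ m) : IsHierarchy (restrictFam hnm F) where
  nonempty A hA := (mem_restrictFam.1 hA).1
  univ_mem := mem_restrictFam.2 ⟨⟨⟨0, hn⟩, Finset.mem_univ _⟩, _, hF.univ_mem, by simp⟩
  laminar A hA B hB i hiA hiB := by
    obtain ⟨-, A', hA', hAA⟩ := mem_restrictFam.1 hA
    obtain ⟨-, B', hB', hBB⟩ := mem_restrictFam.1 hB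
    rcases hF.laminar A' hA' B' hB' _ ((hAA i).1 hiA) ((hBB i).1 hiB) with h | h
    · exact .inl fun j hj => (hBB j).2 (h ((hAA j).1 hj))
    · exact .inr fun j hj => (hAA j).2 (h ((hBB j).1 hj))
  separates i j hij := by
    refine Fin.castLE_injective hnm (hF.separates _ _ fun A hA => ?_)
    have key : ∀ i j, (∀ A ∈ restrictFam hnm F, i ∈ A ↔ j ∈ A) →
        Fin.castLE hnm i ∈ A → Fin.castLE hnm j ∈ A := by
      intro i j hij hi
      have := (hij (Finset.univ.filter fun l => Fin.castLE hnm l ∈ A)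
        (mem_restrictFam.2 ⟨⟨i, by simpa using hi⟩, A, hA, by simp⟩)).1 (by simpa using hi)
      simpa using this
    exact ⟨key i j hij, key j i fun B hB => (hij B hB).symm⟩

/-- A set of old points, as a set of points that does not contain the new point. -/
def liftOld (A : Finset (Fin n)) : Finset (Fin (n + 1)) := A.map Fin.castSuccEmb

/-- A set of old points, together with the new point. -/
def liftNew (A : Finset (Fin n)) : Finset (Fin (n + 1)) := insert (Fin.last n) (liftOld A)

@[simp] theorem castSucc_mem_liftOld {A : Finset (Fin n)} {i : Fin n} :
    i.castSucc ∈ liftOld A ↔ i ∈ A := by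
  simp [liftOld]

@[simp] theorem last_notMem_liftOld {A : Finset (Fin n)} : Fin.last n ∉ liftOld A := by
  simp [liftOld, Fin.castSucc_ne_last]

@[simp] theorem castSucc_mem_liftNew {A : Finset (Fin n)} {i : Fin n} :
    i.castSucc ∈ liftNew A ↔ i ∈ A := by
  simp [liftNew, Fin.castSucc_ne_last]

@[simp] theorem last_mem_liftNew {A : Finset (Fin n)} : Fin.last n ∈ liftNew A := by
  simp [liftNew]

theorem eq_lift (B : Finset (Fin (n + 1))) : (∃ A, B = liftOld A) ∨ ∃ A, B = liftNew A := by
  by_cases h : Fin.last n ∈ B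
  · refine .inr ⟨Finset.univ.filter fun i => i.castSucc ∈ B, ?_⟩
    ext j
    induction j using Fin.lastCases <;> simp [h]
  · refine .inl ⟨Finset.univ.filter fun i => i.castSucc ∈ B, ?_⟩
    ext j
    induction j using Fin.lastCases <;> simp [h]

@[simp] theorem liftOld_subset_liftOld {A B : Finset (Fin n)} :
    liftOld A ⊆ liftOld B ↔ A ⊆ B := by
  simp [Finset.subset_iff, Fin.forall_fin_succ']

@[simp] theorem liftOld_subset_liftNew {A B : Finset (Fin n)} :
    liftOld A ⊆ liftNew B ↔ A ⊆ B := by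
  simp [Finset.subset_iff, Fin.forall_fin_succ']

@[simp] theorem liftNew_subset_liftNew {A B : Finset (Fin n)} :
    liftNew A ⊆ liftNew B ↔ A ⊆ B := by
  simp [Finset.subset_iff, Fin.forall_fin_succ']

@[simp] theorem not_liftNew_subset_liftOld {A B : Finset (Fin n)} :
    ¬ liftNew A ⊆ liftOld B := by
  simp [Finset.subset_iff, Fin.forall_fin_succ']

@[simp] theorem liftOld_inj {A B : Finset (Fin n)} : liftOld A = liftOld B ↔ A = B := by
  simp [Finset.Subset.antisymm_iff]

@[simp] theorem liftNew_inj {A B : Finset (Fin n)} : liftNew A = liftNew B ↔ A = B := by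
  simp [Finset.Subset.antisymm_iff]

@[simp] theorem liftNew_ne_liftOld {A B : Finset (Fin n)} : liftNew A ≠ liftOld B := by
  simp [Finset.Subset.antisymm_iff]

@[simp] theorem liftOld_ne_liftNew {A B : Finset (Fin n)} : liftOld A ≠ liftNew B :=
  liftNew_ne_liftOld.symm

theorem liftNew_univ : liftNew (Finset.univ : Finset (Fin n)) = Finset.univ := by
  ext j
  induction j using Fin.lastCases <;> simp

theorem liftOld_empty : liftOld (∅ : Finset (Fin n)) = ∅ := by
  simp [liftOld]

theorem mem_restrictFam_succ {F : Finset (Finset (Fin (n + 1)))} {A : Finset (Fin n)} :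
    A ∈ restrictFam n.le_succ F ↔ A.Nonempty ∧ (liftOld A ∈ F ∨ liftNew A ∈ F) := by
  rw [mem_restrictFam]
  refine and_congr_right fun _ => ⟨?_, ?_⟩
  · rintro ⟨B, hB, hAB⟩
    rcases eq_lift B with ⟨C, rfl⟩ | ⟨C, rfl⟩
    · have : A = C := by
        ext i
        exact (hAB i).trans castSucc_mem_liftOld
      exact .inl (this ▸ hB)
    · have : A = C := by
        ext i
        exact (hAB i).trans castSucc_mem_liftNew
      exact .inr (this ▸ hB)
  · rintro (h | h)
    · exact ⟨_, h, fun i => castSucc_mem_liftOld.symm⟩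
    · exact ⟨_, h, fun i => castSucc_mem_liftNew.symm⟩

open scoped Classical in
/-- Add a new point to the members of `F` above `M`; then, optionally, add the original set `M` and
the singleton of the new point. -/
noncomputable def extendFam (F : Finset (Finset (Fin n))) (M : Finset (Fin n)) (a b : Bool) :
    Finset (Finset (Fin (n + 1))) :=
  (F.image fun A => if M ⊆ A then liftNew A else liftOld A) ∪
    ((if a then {liftOld M} else ∅) ∪ (if b then {liftNew ∅} else ∅))

theorem liftOld_mem_extendFam {F : Finset (Finset (Fin n))} {M A : Finset (Fin n)} {a b : Bool}
    (hM : M ∈ F) : liftOld A ∈ extendFam F M a b ↔ A ∈ F ∧ (M ⊆ A → A = M ∧ a) := by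
  classical
  have h1 : (∃ B ∈ F, (if M ⊆ B then liftNew B else liftOld B) = liftOld A) ↔
      A ∈ F ∧ ¬ M ⊆ A := by
    constructor
    · rintro ⟨B, hB, hBA⟩
      split_ifs at hBA with h
      · exact absurd hBA liftNew_ne_liftOld
      · rw [liftOld_inj] at hBA
        exact hBA ▸ ⟨hB, h⟩
    · rintro ⟨hA, h⟩
      exact ⟨A, hA, if_neg h⟩
  simp only [extendFam, Finset.mem_union, Finset.mem_image, h1]
  have h2 : liftOld A ∈ (if a then {liftOld M} else ∅ : Finset (Finset (Fin (n + 1)))) ↔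
      A = M ∧ a := by
    cases a <;> simp
  have h3 : liftOld A ∉ (if b then {liftNew ∅} else ∅ : Finset (Finset (Fin (n + 1)))) := by
    cases b <;> simp
  rw [h2]
  constructor
  · rintro (⟨h, h'⟩ | ⟨rfl, h⟩ | h)
    · exact ⟨h, fun h4 => absurd h4 h'⟩
    · exact ⟨hM, fun _ => ⟨rfl, h⟩⟩
    · exact absurd h h3
  · rintro ⟨h, h'⟩
    by_cases h4 : M ⊆ A
    · exact .inr (.inl (h' h4))
    · exact .inl ⟨h, h4⟩

theorem liftNew_mem_extendFam {F : Finset (Finset (Fin n))} {M A : Finset (Fin n)} {a b : Bool} :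
    liftNew A ∈ extendFam F M a b ↔ (A ∈ F ∧ M ⊆ A) ∨ (A = ∅ ∧ b) := by
  classical
  have h1 : (∃ B ∈ F, (if M ⊆ B then liftNew B else liftOld B) = liftNew A) ↔
      A ∈ F ∧ M ⊆ A := by
    constructor
    · rintro ⟨B, hB, hBA⟩
      split_ifs at hBA with h
      · rw [liftNew_inj] at hBA
        exact hBA ▸ ⟨hB, h⟩
      · exact absurd hBA liftOld_ne_liftNew
    · rintro ⟨hA, h⟩
      exact ⟨A, hA, if_pos h⟩
  simp only [extendFam, Finset.mem_union, Finset.mem_image, h1]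
  have h2 : liftNew A ∉ (if a then {liftOld M} else ∅ : Finset (Finset (Fin (n + 1)))) := by
    cases a <;> simp
  have h3 : liftNew A ∈ (if b then {liftNew ∅} else ∅ : Finset (Finset (Fin (n + 1)))) ↔
      A = ∅ ∧ b := by
    cases b <;> simp
  rw [h3]
  simp only [h2, false_or]

theorem card_extendFam {F : Finset (Finset (Fin n))} (hF : IsHierarchy F) {M : Finset (Fin n)}
    (hM : M ∈ F) (a b : Bool) : (extendFam F M a b).card = F.card + a.toNat + b.toNat := by
  classical
  have hne := hF.nonempty M hM
  rw [extendFam, Finset.card_union_of_disjoint, Finset.card_union_of_disjoint,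
    Finset.card_image_of_injective, add_assoc]
  · congr 2 <;> split_ifs with h <;> simp [h]
  · intro A B hAB
    simp only at hAB
    split_ifs at hAB <;> simp at hAB <;> exact hAB
  · cases a <;> cases b <;> simp
  · rw [Finset.disjoint_left]
    intro B hB hB'
    obtain ⟨A, hA, rfl⟩ := Finset.mem_image.1 hB
    have hA' := hF.nonempty A hA
    by_cases h : M ⊆ A
    · cases a <;> cases b <;> simp [h, hA'.ne_empty] at hB'
    · have : A ≠ M := fun he => h he.ge
      cases a <;> cases b <;> simp [h, this] at hB'

/-- `M` is recovered as the least nonempty old part of a member containing the new point; `a` and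
`b` are read off from membership. -/
theorem extendFam_injective {F : Finset (Finset (Fin n))} (hF : IsHierarchy F)
    {M M' : Finset (Fin n)} (hM : M ∈ F) (hM' : M' ∈ F) {a b a' b' : Bool}
    (h : extendFam F M a b = extendFam F M' a' b') : M = M' ∧ a = a' ∧ b = b' := by
  have hsub : ∀ {M M' : Finset (Fin n)} {a b a' b' : Bool}, M ∈ F →
      extendFam F M a b = extendFam F M' a' b' → M' ⊆ M := by
    intro M M' a b a' b' hM h
    have h1 : liftNew M ∈ extendFam F M a b := liftNew_mem_extendFam.2 (.inl ⟨hM, subset_rfl⟩)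
    rw [h, liftNew_mem_extendFam] at h1
    exact (h1.resolve_right fun h2 => (hF.nonempty M hM).ne_empty h2.1).2
  obtain rfl : M = M' := (hsub hM' h.symm).antisymm (hsub hM h)
  have hempty : ∅ ∉ F := fun h0 => (hF.nonempty ∅ h0).ne_empty rfl
  have h1 : liftOld M ∈ extendFam F M a b ↔ liftOld M ∈ extendFam F M a' b' := by rw [h]
  have h2 : liftNew ∅ ∈ extendFam F M a b ↔ liftNew ∅ ∈ extendFam F M a' b' := by rw [h]
  simp only [liftOld_mem_extendFam hM, liftNew_mem_extendFam, hM, hempty, subset_rfl, true_and,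
    false_and, false_or, forall_const] at h1 h2
  exact ⟨rfl, Bool.eq_iff_iff.2 h1, Bool.eq_iff_iff.2 h2⟩

theorem restrictFam_extendFam {F : Finset (Finset (Fin n))} (hF : IsHierarchy F)
    {M : Finset (Fin n)} (hM : M ∈ F) (a b : Bool) :
    restrictFam n.le_succ (extendFam F M a b) = F := by
  ext A
  rw [mem_restrictFam_succ, liftOld_mem_extendFam hM, liftNew_mem_extendFam]
  constructor
  · rintro ⟨hA, ⟨h, -⟩ | ⟨h, -⟩ | ⟨h, -⟩⟩
    · exact h
    · exact h
    · exact absurd h hA.ne_empty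
  · intro hA
    refine ⟨hF.nonempty A hA, ?_⟩
    by_cases h : M ⊆ A
    · exact .inr (.inl ⟨hA, h⟩)
    · exact .inl ⟨hA, fun h' => absurd h' h⟩

/-- With neither optional set, the new label goes on the vertex `M` itself, so `M` must be
unlabeled; this is what `hab` demands. -/
theorem isHierarchy_extendFam {F : Finset (Finset (Fin n))} (hF : IsHierarchy F)
    {M : Finset (Fin n)} (hM : M ∈ F) {a b : Bool}
    (hab : a ∨ b ∨ ∀ i, (hF.least i).1 ≠ M) : IsHierarchy (extendFam F M a b) where
  nonempty B hB := by
    rcases eq_lift B with ⟨A, rfl⟩ | ⟨A, rfl⟩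
    · obtain ⟨i, hi⟩ := hF.nonempty A ((liftOld_mem_extendFam hM).1 hB).1
      exact ⟨i.castSucc, by simpa using hi⟩
    · exact ⟨Fin.last n, by simp⟩
  univ_mem := by
    rw [← liftNew_univ, liftNew_mem_extendFam]
    exact .inl ⟨hF.univ_mem, Finset.subset_univ _⟩
  laminar := by
    have key : ∀ A C : Finset (Fin n), liftOld A ∈ extendFam F M a b →
        liftNew C ∈ extendFam F M a b → ∀ i ∈ liftOld A, i ∈ liftNew C →
          liftOld A ⊆ liftNew C := by
      intro A C hA hC i hiA hiC
      rw [liftOld_mem_extendFam hM] at hA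
      rw [liftNew_mem_extendFam] at hC
      induction i using Fin.lastCases with
      | last => exact absurd hiA last_notMem_liftOld
      | cast i =>
        rw [castSucc_mem_liftOld] at hiA
        rw [castSucc_mem_liftNew] at hiC
        rcases hC with ⟨hC, hMC⟩ | ⟨rfl, -⟩
        · rw [liftOld_subset_liftNew]
          rcases hF.laminar A hA.1 C hC i hiA hiC with h | h
          · exact h
          · rw [(hA.2 (hMC.trans h)).1]
            exact hMC
        · exact absurd hiC (Finset.notMem_empty i)
    intro B hB D hD i hiB hiD
    rcases eq_lift B with ⟨A, rfl⟩ | ⟨A, rfl⟩ <;> rcases eq_lift D with ⟨C, rfl⟩ | ⟨C, rfl⟩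
    · rw [liftOld_mem_extendFam hM] at hB hD
      induction i using Fin.lastCases with
      | last => exact absurd hiB last_notMem_liftOld
      | cast i =>
        rw [castSucc_mem_liftOld] at hiB hiD
        simpa using hF.laminar A hB.1 C hD.1 i hiB hiD
    · exact .inl (key A C hB hD i hiB hiD)
    · exact .inr (key C A hD hB i hiD hiB)
    · rw [liftNew_mem_extendFam] at hB hD
      simp only [liftNew_subset_liftNew]
      rcases hB with ⟨hA, hMA⟩ | ⟨rfl, -⟩
      · rcases hD with ⟨hC, hMC⟩ | ⟨rfl, -⟩
        · obtain ⟨j, hj⟩ := hF.nonempty M hM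
          exact hF.laminar A hA C hC j (hMA hj) (hMC hj)
        · exact .inr (Finset.empty_subset _)
      · exact .inl (Finset.empty_subset _)
  separates := by
    have hlast : ∀ i : Fin n,
        ¬ ∀ B ∈ extendFam F M a b, i.castSucc ∈ B ↔ Fin.last n ∈ B := by
      intro i h
      have hiM : i ∈ M := by
        have := h (liftNew M) (liftNew_mem_extendFam.2 (.inl ⟨hM, subset_rfl⟩))
        simpa using this
      rcases hab with hab | hab | hab
      · have := h (liftOld M) ((liftOld_mem_extendFam hM).2 ⟨hM, fun _ => ⟨rfl, hab⟩⟩)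
        simp [hiM] at this
      · have := h (liftNew ∅) (liftNew_mem_extendFam.2 (.inr ⟨rfl, hab⟩))
        simp at this
      -- Here the least member containing `i` is strictly inside `M`, so it did not receive the new
      -- point.
      · have hle : (hF.least i).1 ⊆ M := (hF.least_le_iff i ⟨M, hM⟩).2 hiM
        have := h (liftOld (hF.least i).1) ((liftOld_mem_extendFam hM).2 ⟨(hF.least i).2,
          fun h' => absurd (hle.antisymm h') (hab i)⟩)
        have h2 : i ∈ (hF.least i).1 := (hF.least_le_iff i (hF.least i)).1 le_rfl
        simp [h2] at this
    intro i j hij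
    induction i using Fin.lastCases with
    | last =>
      induction j using Fin.lastCases with
      | last => rfl
      | cast j => exact absurd (fun B hB => (hij B hB).symm) (hlast j)
    | cast i =>
      induction j using Fin.lastCases with
      | last => exact absurd hij (hlast i)
      | cast j =>
        refine congrArg _ (hF.separates i j fun A hA => ?_)
        by_cases h : M ⊆ A
        · simpa using hij (liftNew A) (liftNew_mem_extendFam.2 (.inl ⟨hA, h⟩))
        · simpa using hij (liftOld A)
            ((liftOld_mem_extendFam hM).2 ⟨hA, fun h' => absurd h' h⟩)

/-- The members containing the new point form a chain; `M` is the smallest nonempty old part among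
them. A member without the new point whose old part contains `M` must, by laminarity, equal `M`. -/
theorem exists_eq_extendFam {F' : Finset (Finset (Fin (n + 1)))} (hF' : IsHierarchy F')
    (hF : IsHierarchy (restrictFam n.le_succ F')) :
    ∃ M ∈ restrictFam n.le_succ F', ∃ a b : Bool,
      (a ∨ b ∨ ∀ i, (hF.least i).1 ≠ M) ∧ extendFam (restrictFam n.le_succ F') M a b = F' := by
  classical
  have hr : ∀ A : Finset (Fin n), A ∈ restrictFam n.le_succ F' ↔
      A.Nonempty ∧ (liftOld A ∈ F' ∨ liftNew A ∈ F') := fun A => mem_restrictFam_succ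
  generalize restrictFam n.le_succ F' = F at hF hr ⊢
  obtain ⟨M, hM⟩ := (F.filter fun A => liftNew A ∈ F').exists_minimal
    ⟨Finset.univ, by simp [hF.univ_mem, liftNew_univ, hF'.univ_mem]⟩
  have hMF := Finset.mem_filter.1 hM.1
  have hmin : ∀ A ∈ F, liftNew A ∈ F' → M ⊆ A := by
    intro A hA hA'
    have := hF'.laminar _ hMF.2 _ hA' (Fin.last n) (by simp) (by simp)
    rw [liftNew_subset_liftNew, liftNew_subset_liftNew] at this
    exact this.elim id fun h => hM.2 (Finset.mem_filter.2 ⟨hA, hA'⟩) h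
  have hold : ∀ A, liftOld A ∈ F' → A ∈ F := by
    refine fun A hA => (hr A).2 ⟨?_, .inl hA⟩
    rw [Finset.nonempty_iff_ne_empty]
    rintro rfl
    exact (hF'.nonempty _ hA).ne_empty liftOld_empty
  have heq : ∀ A, liftOld A ∈ F' → M ⊆ A → A = M := by
    intro A hA hMA
    obtain ⟨j, hj⟩ := hF.nonempty M hMF.1
    have := hF'.laminar _ hA _ hMF.2 j.castSucc (by simpa using hMA hj) (by simpa using hj)
    rw [liftOld_subset_liftNew] at this
    exact (this.resolve_right not_liftNew_subset_liftOld).antisymm hMA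
  refine ⟨M, hMF.1, decide (liftOld M ∈ F'), decide (liftNew ∅ ∈ F'), ?_, ?_⟩
  · simp only [decide_eq_true_eq]
    by_contra hcon
    push Not at hcon
    obtain ⟨ha, hb, i, hi⟩ := hcon
    have hiM : i ∈ M := by
      rw [← hi]
      exact (hF.least_le_iff i (hF.least i)).1 le_rfl
    refine Fin.castSucc_ne_last i (hF'.separates _ _ fun B hB => ?_)
    rcases eq_lift B with ⟨A, rfl⟩ | ⟨A, rfl⟩
    · simp only [castSucc_mem_liftOld, last_notMem_liftOld, iff_false]
      intro hiA
      have hMA : M ⊆ A := hi ▸ (hF.least_le_iff i ⟨A, hold A hB⟩).2 hiA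
      exact ha (heq A hB hMA ▸ hB)
    · simp only [castSucc_mem_liftNew, last_mem_liftNew, iff_true]
      have hA : A.Nonempty := by
        rw [Finset.nonempty_iff_ne_empty]
        rintro rfl
        exact hb hB
      exact hmin A ((hr A).2 ⟨hA, .inr hB⟩) hB hiM
  · ext B
    rcases eq_lift B with ⟨A, rfl⟩ | ⟨A, rfl⟩
    · rw [liftOld_mem_extendFam hMF.1, decide_eq_true_eq]
      constructor
      · rintro ⟨hA, h⟩
        by_cases hMA : M ⊆ A
        · obtain ⟨rfl, h⟩ := h hMA
          exact h
        · exact ((hr A).1 hA).2.resolve_right fun h' => hMA (hmin A hA h')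
      · intro hA
        refine ⟨hold A hA, fun h => ?_⟩
        obtain rfl := heq A hA h
        exact ⟨rfl, hA⟩
    · rw [liftNew_mem_extendFam, decide_eq_true_eq]
      constructor
      · rintro (⟨hA, hMA⟩ | ⟨rfl, h⟩)
        · rcases ((hr A).1 hA).2 with h | h
          · rw [heq A h hMA]
            exact hMF.2
          · exact h
        · exact h
      · intro hA
        rcases A.eq_empty_or_nonempty with rfl | hne
        · exact .inr ⟨rfl, hA⟩
        · have := (hr A).2 ⟨hne, .inr hA⟩
          exact .inl ⟨this, hmin A this hA⟩

theorem IsHierarchy.card_filter_least {F : Finset (Finset (Fin n))} (hF : IsHierarchy F)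
    [DecidablePred fun M => ∀ i, (hF.least i).1 ≠ M] :
    (F.filter fun M => ∀ i, (hF.least i).1 ≠ M).card + n = F.card := by
  classical
  have h1 : (F.filter fun M => ¬ ∀ i, (hF.least i).1 ≠ M) =
      Finset.univ.image fun i => (hF.least i).1 := by
    ext M
    simp only [Finset.mem_filter, Finset.mem_image, Finset.mem_univ, true_and, not_forall, not_not]
    exact ⟨fun h => h.2, fun h => ⟨by obtain ⟨i, rfl⟩ := h; exact (hF.least i).2, h⟩⟩
  have h2 := F.card_filter_add_card_filter_not fun M => ∀ i, (hF.least i).1 ≠ M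
  have h3 : Function.Injective fun i => (hF.least i).1 :=
    Subtype.val_injective.comp hF.least_injective
  rw [h1, Finset.card_image_of_injective _ h3,
    Finset.card_univ, Fintype.card_fin] at h2
  exact h2

open scoped Classical in
/-- The hierarchies on `n` points. -/
noncomputable def hierarchies (n : ℕ) : Finset (Finset (Finset (Fin n))) :=
  Finset.univ.filter IsHierarchy

theorem mem_hierarchies {F : Finset (Finset (Fin n))} : F ∈ hierarchies n ↔ IsHierarchy F := by
  simp [hierarchies]

open scoped Classical in
-- The fiber is parametrized by triples `(M, a, b)`: the pair false, false allows only the `F.card -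
-- n` unlabeled `M`, each other pair allows every `M`, and each true flag adds one member.
theorem sum_restrictFam_eq {R : Type*} [CommSemiring R] (g : ℕ → R)
    {F : Finset (Finset (Fin n))} (hF : IsHierarchy F) :
    ∑ F' ∈ hierarchies (n + 1) with restrictFam n.le_succ F' = F, g F'.card =
      (F.card - n : ℕ) * g F.card + 2 * F.card * g (F.card + 1) + F.card * g (F.card + 2) := by
  let I : Finset (Finset (Fin n) × Bool × Bool) := (F ×ˢ Finset.univ).filter fun p =>
    p.2.1 ∨ p.2.2 ∨ ∀ i, (hF.least i).1 ≠ p.1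
  have hI : ∑ F' ∈ hierarchies (n + 1) with restrictFam n.le_succ F' = F, g F'.card =
      ∑ p ∈ I, g (F.card + p.2.1.toNat + p.2.2.toNat) := by
    symm
    refine Finset.sum_bij (fun p _ => extendFam F p.1 p.2.1 p.2.2) ?_ ?_ ?_ ?_
    · rintro ⟨M, a, b⟩ hp
      simp only [I, Finset.mem_filter, Finset.mem_product, Finset.mem_univ, and_true] at hp
      rw [Finset.mem_filter, mem_hierarchies]
      exact ⟨isHierarchy_extendFam hF hp.1 hp.2, restrictFam_extendFam hF hp.1 a b⟩
    · rintro ⟨M, a, b⟩ hp ⟨M', a', b'⟩ hp' h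
      simp only [I, Finset.mem_filter, Finset.mem_product, Finset.mem_univ, and_true] at hp hp'
      obtain ⟨rfl, rfl, rfl⟩ := extendFam_injective hF hp.1 hp'.1 h
      rfl
    · intro F' hF'
      rw [Finset.mem_filter, mem_hierarchies] at hF'
      obtain ⟨hF', rfl⟩ := hF'
      obtain ⟨M, hM, a, b, hab, h⟩ := exists_eq_extendFam hF' hF
      exact ⟨(M, a, b), by simp [I, hM, hab], h⟩
    · rintro ⟨M, a, b⟩ hp
      simp only [I, Finset.mem_filter, Finset.mem_product, Finset.mem_univ, and_true] at hp
      rw [card_extendFam hF hp.1]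
  have hcard := hF.card_filter_least
  rw [hI, Finset.sum_filter, Finset.sum_product]
  simp only [Fintype.sum_prod_type, Fintype.sum_bool, Bool.toNat_true, Bool.toNat_false,
    Bool.false_eq_true, true_or, or_true, false_or, if_true, add_zero, Finset.sum_add_distrib]
  rw [← Finset.sum_filter]
  simp only [Finset.sum_const, nsmul_eq_mul]
  rw [show F.card - n = (F.filter fun M => ∀ i, (hF.least i).1 ≠ M).card by omega]
  ring

end Fiber

/-! ### Counting restrictions and iterating the derivative -/

section Main
open PowerSeries
variable {n : ℕ}

theorem IsHierarchy.le_card {F : Finset (Finset (Fin n))} (hF : IsHierarchy F) :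
    n ≤ F.card := by
  have := Fintype.card_le_of_injective _ hF.least_injective
  simpa using this

theorem IsHierarchy.restrictFam_self {F : Finset (Finset (Fin n))} (hF : IsHierarchy F) :
    restrictFam le_rfl F = F := by
  ext A
  rw [mem_restrictFam]
  constructor
  · rintro ⟨-, B, hB, hAB⟩
    have : A = B := Finset.ext hAB
    exact this ▸ hB
  · exact fun hA => ⟨hF.nonempty A hA, A, hA, fun i => Iff.rfl⟩

open scoped Classical in
theorem derivative_gregSeries_card {F : Finset (Finset (Fin n))} (hF : IsHierarchy F) :
    derivative ℚ (gregSeries n (F.card - n)) =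
      ∑ F' ∈ hierarchies (n + 1) with restrictFam n.le_succ F' = F,
        gregSeries (n + 1) (F'.card - (n + 1)) := by
  obtain ⟨u, hu⟩ := Nat.exists_eq_add_of_le hF.le_card
  rw [sum_restrictFam_eq (fun c => gregSeries (n + 1) (c - (n + 1))) hF, derivative_gregSeries, hu]
  -- For `u = 0` the truncated index `u - 1` is irrelevant, since its coefficient is `u`.
  rw [show n + u - n = u by omega, show n + u - (n + 1) = u - 1 by omega,
    show n + u + 1 - (n + 1) = u by omega, show n + u + 2 - (n + 1) = u + 1 by omega]
  push_cast
  ring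

theorem RootedCayleyTree.isHierarchy_restrictFam {m : ℕ} (hn : 1 ≤ n) (hnm : n ≤ m)
    (X : RootedCayleyTree m) : IsHierarchy (restrictFam hnm X.fam) :=
  X.isHierarchy_fam.restrict hn hnm

theorem card_restrictFam_fam_self {F : Finset (Finset (Fin n))} (hF : IsHierarchy F) :
    Nat.card {X : RootedCayleyTree n // restrictFam le_rfl X.fam = F} =
      if F.card - n = 0 then 1 else 0 := by
  have hself : ∀ X : RootedCayleyTree n, restrictFam le_rfl X.fam = X.fam :=
    fun X => X.isHierarchy_fam.restrictFam_self
  simp only [hself]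
  split_ifs with h
  · have hc : F.card = n := by have := hF.le_card; omega
    obtain ⟨X, hX⟩ := hF.exists_cayley_fam_eq hc
    rw [Nat.card_eq_one_iff_unique]
    exact ⟨⟨fun Y Z => Subtype.ext (RootedCayleyTree.fam_injective (Y.2.trans Z.2.symm))⟩,
      ⟨X, hX⟩⟩
  · rw [Nat.card_eq_zero]
    refine .inl ⟨fun X => h ?_⟩
    rw [← X.2, RootedCayleyTree.card_fam, Nat.sub_self]

open scoped Classical in
theorem card_restrictFam_fam_succ {m : ℕ} (hnm : n + 1 ≤ m) (F : Finset (Finset (Fin n))) :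
    Nat.card {X : RootedCayleyTree m // restrictFam (n.le_succ.trans hnm) X.fam = F} =
      ∑ F' ∈ hierarchies (n + 1) with restrictFam n.le_succ F' = F,
        Nat.card {X : RootedCayleyTree m // restrictFam hnm X.fam = F'} := by
  have := Fintype.ofFinite (RootedCayleyTree m)
  simp only [Nat.card_eq_fintype_card, Fintype.card_subtype]
  rw [Finset.card_eq_sum_card_fiberwise (f := fun X => restrictFam hnm X.fam)
    (t := (hierarchies (n + 1)).filter fun F' => restrictFam n.le_succ F' = F)]
  · refine Finset.sum_congr rfl fun F' hF' => ?_
    congr 1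
    ext X
    simp only [Finset.mem_filter, Finset.mem_univ, true_and, and_iff_right_iff_imp]
    rintro rfl
    rw [← (Finset.mem_filter.1 hF').2, restrictFam_restrictFam]
  · intro X hX
    simp only [Finset.coe_filter, Finset.mem_univ, true_and, Set.mem_ofPred_eq,
      mem_hierarchies] at hX ⊢
    exact ⟨X.isHierarchy_restrictFam (by omega) hnm, by rw [restrictFam_restrictFam, hX]⟩

/-- In the induction `m` stays fixed and `n` grows: trees over `F` are sorted by their trace on `n +
1` points, matching one differentiation of the series. -/
theorem card_restrictFam_fam (k : ℕ) : ∀ {n m : ℕ} (hnm : n ≤ m), m = n + k →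
    ∀ {F : Finset (Finset (Fin n))}, IsHierarchy F →
      (Nat.card {X : RootedCayleyTree m // restrictFam hnm X.fam = F} : ℚ) =
        k.factorial * coeff k (gregSeries n (F.card - n)) := by
  classical
  induction k with
  | zero =>
    rintro n m hnm rfl F hF
    rw [card_restrictFam_fam_self hF, coeff_zero_eq_constantCoeff_apply, constantCoeff_gregSeries]
    simp
  | succ k ih =>
    intro n m hnm hm F hF
    have hnm' : n + 1 ≤ m := by omega
    have h := congrArg (coeff k) (derivative_gregSeries_card hF)
    rw [coeff_derivative, map_sum] at h
    rw [card_restrictFam_fam_succ hnm', Nat.cast_sum, Nat.factorial_succ, Nat.cast_mul,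
      mul_right_comm, mul_comm, mul_comm (((k + 1 : ℕ) : ℚ)), Nat.cast_succ, h, Finset.mul_sum]
    refine Finset.sum_congr rfl fun F' hF' => ?_
    exact ih hnm' (by omega) (mem_hierarchies.1 (Finset.mem_filter.1 hF').1)

theorem restrictionSeries_eq (T : RootedGregTree n) :
    restrictionSeries T = gregSeries n T.unl := by
  ext k
  have hcard : Nat.card {X : RootedCayleyTree (n + k) // X.RestrictsTo (n.le_add_right k) T} =
      Nat.card {X : RootedCayleyTree (n + k) // restrictFam (n.le_add_right k) X.fam = T.fam} := by
    refine Nat.card_congr (Equiv.subtypeEquivRight fun X => ?_)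
    rw [RootedCayleyTree.restrictsTo_iff T.pos, RootedCayleyTree.fam_forget, eq_comm]
  rw [restrictionSeries, coeff_mk, hcard, card_restrictFam_fam k _ rfl T.isHierarchy,
    ← T.unl_add, Nat.add_sub_cancel]
  exact mul_div_cancel_left₀ _ (by exact_mod_cast k.factorial_ne_zero)

theorem sum_rootedGregTree {R : Type*} [AddCommMonoid R] (g : ℕ → R) :
    ∑ T : RootedGregTree n, g T.unl = ∑ F ∈ hierarchies n, g (F.card - n) := by
  refine Finset.sum_bij (fun T _ => T.fam) (fun T _ => mem_hierarchies.2 T.isHierarchy)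
    (fun S _ T _ h => RootedGregTree.fam_injective h) (fun F hF => ?_) (fun T _ => ?_)
  · obtain ⟨T, hT⟩ := (mem_hierarchies.1 hF).exists_fam_eq
    exact ⟨T, Finset.mem_univ _, hT⟩
  · rw [← T.unl_add, Nat.add_sub_cancel]

theorem hierarchies_one : hierarchies 1 = {{Finset.univ}} := by
  ext F
  rw [mem_hierarchies, Finset.mem_singleton]
  have huniv : ∀ A : Finset (Fin 1), A.Nonempty → A = Finset.univ := by decide
  constructor
  · intro hF
    ext A
    rw [Finset.mem_singleton]
    exact ⟨fun hA => huniv A (hF.nonempty A hA), fun hA => hA ▸ hF.univ_mem⟩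
  · rintro rfl
    refine ⟨?_, by simp, ?_, fun i j _ => Subsingleton.elim i j⟩
    · simp
    · simp

/-- The start is `T' = e^T/(1-T)`, the series of the only hierarchy on one point; each further
derivative replaces a hierarchy by its one-point extensions. -/
theorem iterate_derivative_treeFunction (n : ℕ) :
    (derivative ℚ)^[n + 1] treeFunction =
      ∑ F ∈ hierarchies (n + 1), gregSeries (n + 1) (F.card - (n + 1)) := by
  classical
  induction n with
  | zero =>
    rw [hierarchies_one]
    simp [gregSeries, derivative_treeFunction]
  | succ n ih =>
    rw [Function.iterate_succ_apply', ih, map_sum]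
    rw [← Finset.sum_fiberwise_of_maps_to (s := hierarchies (n + 1 + 1)) (t := hierarchies (n + 1))
      (g := restrictFam (n + 1).le_succ) fun F hF => mem_hierarchies.2
        ((mem_hierarchies.1 hF).restrict (by omega) _)]
    exact Finset.sum_congr rfl fun F hF => derivative_gregSeries_card (mem_hierarchies.1 hF)

end Main
end GregTree

theorem mainTheorem3 (n : ℕ) :
    (1 ≤ n → ∀ (m : ℕ) (hnm : n ≤ m) (X : GregTree.RootedCayleyTree m),
      ∃! T : GregTree.RootedGregTree n, X.RestrictsTo hnm T) ∧
    (∀ T : GregTree.RootedGregTree n,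
      GregTree.restrictionSeries T =
        GregTree.expTree n * ((1 - GregTree.treeFunction)⁻¹) ^ n *
          (GregTree.treeFunction * (1 - GregTree.treeFunction)⁻¹) ^ T.unl) ∧
    (1 ≤ n →
      (PowerSeries.derivative ℚ)^[n] GregTree.treeFunction =
        GregTree.expTree n * ((1 - GregTree.treeFunction)⁻¹) ^ n *
          Polynomial.aeval (GregTree.treeFunction * (1 - GregTree.treeFunction)⁻¹)
            (GregTree.gregPoly n)) := by
  refine ⟨fun hn m hnm X => ?_, GregTree.restrictionSeries_eq, fun hn => ?_⟩
  · obtain ⟨T, hT⟩ := (X.isHierarchy_restrictFam hn hnm).exists_fam_eq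
    simp only [GregTree.RootedCayleyTree.restrictsTo_iff hn, GregTree.RootedCayleyTree.fam_forget]
    exact ⟨T, hT, fun S hS => GregTree.RootedGregTree.fam_injective (hS.trans hT.symm)⟩
  · obtain ⟨n, rfl⟩ : ∃ k, n = k + 1 := ⟨n - 1, by omega⟩
    rw [GregTree.iterate_derivative_treeFunction, ← GregTree.sum_rootedGregTree, GregTree.gregPoly,
      map_sum, Finset.mul_sum]
    simp [GregTree.gregSeries]
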